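/- For $n\ge 1$ let $\mathrm{Aut}(\mathbb A^n_{\mathbb C})$ be the group, under composition, of polynomial automorphisms $f=(f_1,\dots,f_n)$, $f_i\in\mathbb C[x_1,\dots,x_n]$, of complex affine $n$-space, and let the triangular (Jonquières) subgroup be $$\mathcal B_n=\{f\in\mathrm{Aut}(\mathbb A^n_{\mathbb C}) \mid \forall i,\ f_i=a_ix_i+p_i,\ a_i\in\mathbb C^*,\ p_i\in\mathbb C[x_{i+1},\dots,x_n]\}.$$ For $d\ge 0$ let $\mathrm{Aut}(\mathbb A^n_{\mathbb C})_{\le d}$ be the set of automorphisms with $\deg f_i\le d$ for all $i$, with the Zariski topology induced from the affine space $(\mathbb C[x_1,\dots,x_n]_{\le d})^n$ of coefficients. The ind-topology on $\mathrm{Aut}(\mathbb A^n_{\mathbb C})$ is the one in which a subset $S$ is closed if and only if $S\cap\mathrm{Aut}(\mathbb A^n_{\mathbb C})_{\le d}$ is closed in $\mathrm{Aut}(\mathbb A^n_{\mathbb C})_{\le d}$ for every $d$. Then: (1) For every $n\ge 2$, $\mathcal B_n$ is maximal among all solvable subgroups of $\mathrm{Aut}(\mathbb A^n_{\mathbb C})$: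 it is solvable, and it is not strictly contained in any solvable subgroup. (2) $\mathcal B_2$ is maximal among the proper closed subgroups of $\mathrm{Aut}(\mathbb A^2_{\mathbb C})$ for the ind-topology: it is a proper closed subgroup, and the only closed subgroup strictly containing it is $\mathrm{Aut}(\mathbb A^2_{\mathbb C})$. (3) $\mathcal B_2$ is not maximal among all proper subgroups of the abstract group $\mathrm{Aut}(\mathbb A^2_{\mathbb C})$: there is a subgroup $H$ with $\mathcal B_2\subsetneq H\subsetneq\mathrm{Aut}(\mathbb A^2_{\mathbb C})$. -/

import Mathlib

open MvPolynomial Topology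

/-- A polynomial endomorphism `f = (f₁, …, fₙ)` of affine `n`-space over `𝕜`, given by its
component polynomials. -/
@[ext]
structure PolyEnd (n : ℕ) (𝕜 : Type*) [Field 𝕜] where
  /-- The components `f₁, …, fₙ ∈ 𝕜[x₁, …, xₙ]`. -/
  comp : Fin n → MvPolynomial (Fin n) 𝕜

namespace PolyEnd

/-- The monoid `End(𝔸ⁿ)` under composition: `g * f = g ∘ f = (g₁(f₁,…,fₙ), …, gₙ(f₁,…,fₙ))`,
with unit `(x₁, …, xₙ)`. -/
noncomputable instance (n : ℕ) (𝕜 : Type*) [Field 𝕜] : Monoid (PolyEnd n 𝕜) where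
  mul g f := ⟨fun i => bind₁ f.comp (g.comp i)⟩
  one := ⟨fun i => X i⟩
  mul_assoc h g f := by
    ext1
    funext i
    exact bind₁_bind₁ g.comp f.comp (h.comp i)
  one_mul f := by
    ext1
    funext i
    exact bind₁_X_right f.comp i
  mul_one f := by
    ext1
    funext i
    change bind₁ (fun j => X j) (f.comp i) = f.comp i
    have h := bind₁_X_left (σ := Fin n) (R := 𝕜)
    exact congrArg (fun φ : MvPolynomial (Fin n) 𝕜 →ₐ[𝕜] MvPolynomial (Fin n) 𝕜 =>
      φ (f.comp i)) h

theorem mul_comp {n : ℕ} {𝕜 : Type*} [Field 𝕜] (g f : PolyEnd n 𝕜) (i : Fin n) :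
    (g * f).comp i = bind₁ f.comp (g.comp i) := rfl

theorem one_comp {n : ℕ} {𝕜 : Type*} [Field 𝕜] (i : Fin n) :
    (1 : PolyEnd n 𝕜).comp i = X i := rfl

end PolyEnd

/-- The group `Aut(𝔸ⁿ)` of polynomial automorphisms of affine `n`-space: the endomorphisms that
are invertible for composition. -/
abbrev PolyAut (n : ℕ) (𝕜 : Type*) [Field 𝕜] : Type _ := (PolyEnd n 𝕜)ˣ

/-- The `i`-th component of `f` has the triangular form `aᵢ xᵢ + pᵢ` with `aᵢ ≠ 0` and
`pᵢ ∈ 𝕜[xᵢ₊₁, …, xₙ]`, for every `i`. -/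
def PolyEnd.IsTriangular {n : ℕ} {𝕜 : Type*} [Field 𝕜] (f : PolyEnd n 𝕜) : Prop :=
  ∀ i : Fin n, ∃ a : 𝕜, a ≠ 0 ∧ ∃ p ∈ supported 𝕜 {j : Fin n | i < j},
    f.comp i = C a * X i + p

/-- Substituting polynomials taken from a subalgebra into a polynomial in the variables of `s`
stays in that subalgebra. -/
theorem bind₁_mem_of_mem_supported {n : ℕ} {𝕜 : Type*} [Field 𝕜] {s : Set (Fin n)}
    {p : MvPolynomial (Fin n) 𝕜} (hp : p ∈ supported 𝕜 s)
    (g : Fin n → MvPolynomial (Fin n) 𝕜) (A : Subalgebra 𝕜 (MvPolynomial (Fin n) 𝕜))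
    (hg : ∀ j ∈ s, g j ∈ A) : bind₁ g p ∈ A := by
  have h : supported 𝕜 s ≤ A.comap (bind₁ g) := by
    refine Algebra.adjoin_le ?_
    rintro _ ⟨j, hj, rfl⟩
    change bind₁ g (X j) ∈ A
    rw [bind₁_X_right]
    exact hg j hj
  exact h hp

theorem PolyEnd.IsTriangular.comp_mem {n : ℕ} {𝕜 : Type*} [Field 𝕜] {f : PolyEnd n 𝕜}
    (hf : f.IsTriangular) {i j : Fin n} (hij : i < j) :
    f.comp j ∈ supported 𝕜 {k : Fin n | i < k} := by
  obtain ⟨a, -, p, hp, h⟩ := hf j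
  rw [h]
  refine add_mem (mul_mem (Subalgebra.algebraMap_mem _ a) (X_mem_supported.2 hij)) ?_
  exact supported_mono (fun k (hk : j < k) => hij.trans hk) hp

theorem PolyEnd.IsTriangular.one {n : ℕ} {𝕜 : Type*} [Field 𝕜] :
    (1 : PolyEnd n 𝕜).IsTriangular := fun i =>
  ⟨1, one_ne_zero, 0, zero_mem _, by simp [PolyEnd.one_comp]⟩

theorem PolyEnd.IsTriangular.mul {n : ℕ} {𝕜 : Type*} [Field 𝕜] {g f : PolyEnd n 𝕜}
    (hg : g.IsTriangular) (hf : f.IsTriangular) : (g * f).IsTriangular := by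
  intro i
  obtain ⟨a, ha, p, hp, h⟩ := hg i
  obtain ⟨b, hb, q, hq, h'⟩ := hf i
  refine ⟨a * b, mul_ne_zero ha hb, C a * q + bind₁ f.comp p, ?_, ?_⟩
  · refine add_mem (mul_mem (Subalgebra.algebraMap_mem _ a) hq) ?_
    exact bind₁_mem_of_mem_supported hp _ _ (fun j hj => hf.comp_mem hj)
  · rw [PolyEnd.mul_comp, h, map_add, map_mul, bind₁_C_right, bind₁_X_right, h', C_mul]
    ring

/-- A right inverse of a triangular endomorphism is triangular. -/
theorem PolyEnd.IsTriangular.of_mul_eq_one {n : ℕ} {𝕜 : Type*} [Field 𝕜] {f g : PolyEnd n 𝕜}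
    (hf : f.IsTriangular) (h : f * g = 1) : g.IsTriangular := by
  have key : ∀ i : Fin n, (∀ j : Fin n, i < j → g.comp j ∈ supported 𝕜 {k : Fin n | j ≤ k}) →
      ∃ a : 𝕜, a ≠ 0 ∧ ∃ p ∈ supported 𝕜 {j : Fin n | i < j}, g.comp i = C a * X i + p := by
    intro i ih
    obtain ⟨a, ha, p, hp, hfi⟩ := hf i
    have hi : C a * g.comp i + bind₁ g.comp p = X i := by
      have := congrArg (fun e : PolyEnd n 𝕜 => e.comp i) h
      simpa only [PolyEnd.mul_comp, PolyEnd.one_comp, hfi, map_add, map_mul, bind₁_C_right,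
        bind₁_X_right] using this
    refine ⟨a⁻¹, inv_ne_zero ha, -(C a⁻¹ * bind₁ g.comp p), ?_, ?_⟩
    · refine neg_mem (mul_mem (Subalgebra.algebraMap_mem _ _) ?_)
      refine bind₁_mem_of_mem_supported hp _ _ (fun j hj => ?_)
      exact supported_mono (fun k (hk : j ≤ k) => lt_of_lt_of_le hj hk) (ih j hj)
    · have hC : (C a⁻¹ * C a : MvPolynomial (Fin n) 𝕜) = 1 := by
        rw [← C_mul, inv_mul_cancel₀ ha, C_1]
      calc g.comp i = (C a⁻¹ * C a) * g.comp i := by rw [hC, one_mul]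
        _ = C a⁻¹ * X i + -(C a⁻¹ * bind₁ g.comp p) := by rw [← hi]; ring
  have all : ∀ i : Fin n, g.comp i ∈ supported 𝕜 {k : Fin n | i ≤ k} := by
    intro i
    induction i using WellFoundedGT.induction with
    | ind i ih =>
      obtain ⟨a, -, p, hp, hgi⟩ := key i ih
      rw [hgi]
      refine add_mem (mul_mem (Subalgebra.algebraMap_mem _ a)
        (X_mem_supported.2 (le_refl i))) ?_
      exact supported_mono (fun k (hk : i < k) => hk.le) hp
  exact fun i => key i (fun j _ => all j)

/-- The Jonquières subgroup `𝓑ₙ` of triangular automorphisms of affine `n`-space. -/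
noncomputable def jonquieres (n : ℕ) (𝕜 : Type*) [Field 𝕜] : Subgroup (PolyAut n 𝕜) where
  carrier := {f | (f : PolyEnd n 𝕜).IsTriangular}
  mul_mem' hg hf := PolyEnd.IsTriangular.mul hg hf
  one_mem' := PolyEnd.IsTriangular.one
  inv_mem' {f} hf := PolyEnd.IsTriangular.of_mul_eq_one hf f.mul_inv

/-- The Zariski topology on the affine space `𝕜^ι`: the closed sets are the common zero sets of
sets of polynomials. -/
@[reducible]
def zariskiTopology (ι : Type*) (𝕜 : Type*) [Field 𝕜] : TopologicalSpace (ι → 𝕜) :=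
  TopologicalSpace.ofClosed
    {Z | ∃ S : Set (MvPolynomial ι 𝕜), Z = {x | ∀ P ∈ S, eval x P = 0}}
    ⟨{1}, by simp⟩
    (by
      intro A hA
      refine ⟨{P | ∃ Z ∈ A, ∀ x ∈ Z, eval x P = 0}, Set.ext fun x => ⟨?_, ?_⟩⟩
      · rintro hx P ⟨Z, hZ, hP⟩
        exact hP x (hx Z hZ)
      · intro hx Z hZ
        obtain ⟨S, rfl⟩ := hA hZ
        exact fun P hP => hx P ⟨_, hZ, fun y hy => hy P hP⟩)
    (by
      rintro _ ⟨S, rfl⟩ _ ⟨T, rfl⟩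
      refine ⟨{R | ∃ P ∈ S, ∃ Q ∈ T, R = P * Q}, Set.ext fun x => ⟨?_, ?_⟩⟩
      · rintro (hx | hx) _ ⟨P, hP, Q, hQ, rfl⟩
        · simp [hx P hP]
        · simp [hx Q hQ]
      · intro hx
        by_contra hcon
        simp only [Set.mem_union, Set.mem_ofPred_eq, not_or, not_forall] at hcon
        obtain ⟨⟨P, hP, hP'⟩, Q, hQ, hQ'⟩ := hcon
        have := hx _ ⟨P, hP, Q, hQ, rfl⟩
        rw [map_mul] at this
        exact (mul_ne_zero hP' hQ') this)

/-- The filtration piece `Aut(𝔸ⁿ)_{≤ d}` of automorphisms whose components have degree at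
most `d`. -/
def PolyAut.degreeLE (n : ℕ) (𝕜 : Type*) [Field 𝕜] (d : ℕ) : Set (PolyAut n 𝕜) :=
  {f | ∀ i, ((f : PolyEnd n 𝕜).comp i).totalDegree ≤ d}

/-- The coefficients of the monomials of degree at most `d` in the components of `f`. On
endomorphisms of degree at most `d` these are the coordinates of the affine space
`(𝕜[x₁, …, xₙ]_{≤ d})ⁿ`. -/
def PolyAut.coeffs (n : ℕ) (𝕜 : Type*) [Field 𝕜] (d : ℕ) (f : PolyAut n 𝕜) :
    Fin n × {m : Fin n →₀ ℕ // m.degree ≤ d} → 𝕜 :=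
  fun q => coeff q.2.1 ((f : PolyEnd n 𝕜).comp q.1)

/-- The Zariski topology of `Aut(𝔸ⁿ)_{≤ d}`, as a (locally closed) subvariety of the affine space
`(𝕜[x₁, …, xₙ]_{≤ d})ⁿ`. -/
@[reducible]
def PolyAut.zariskiDegreeLE (n : ℕ) (𝕜 : Type*) [Field 𝕜] (d : ℕ) :
    TopologicalSpace (PolyAut.degreeLE n 𝕜 d) :=
  TopologicalSpace.induced (fun f => PolyAut.coeffs n 𝕜 d f.1)
    (zariskiTopology (Fin n × {m : Fin n →₀ ℕ // m.degree ≤ d}) 𝕜)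

/-- The ind-topology on `Aut(𝔸ⁿ)`: a set is closed if and only if its intersection with every
`Aut(𝔸ⁿ)_{≤ d}` is Zariski closed in `Aut(𝔸ⁿ)_{≤ d}` (see `isClosed_indTopology_iff`). -/
@[reducible]
def indTopology (n : ℕ) (𝕜 : Type*) [Field 𝕜] : TopologicalSpace (PolyAut n 𝕜) :=
  ⨆ d : ℕ, TopologicalSpace.coinduced Subtype.val (PolyAut.zariskiDegreeLE n 𝕜 d)

theorem isClosed_zariskiTopology_iff {ι 𝕜 : Type*} [Field 𝕜] (Z : Set (ι → 𝕜)) :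
    IsClosed[zariskiTopology ι 𝕜] Z ↔
      ∃ S : Set (MvPolynomial ι 𝕜), Z = {x | ∀ P ∈ S, eval x P = 0} := by
  rw [← @isOpen_compl_iff _ _ (zariskiTopology ι 𝕜)]
  change Zᶜᶜ ∈ _ ↔ _
  rw [compl_compl]
  rfl

theorem isClosed_indTopology_iff {n : ℕ} {𝕜 : Type*} [Field 𝕜] (S : Set (PolyAut n 𝕜)) :
    IsClosed[indTopology n 𝕜] S ↔
      ∀ d : ℕ, IsClosed[PolyAut.zariskiDegreeLE n 𝕜 d]
        (Subtype.val ⁻¹' S : Set (PolyAut.degreeLE n 𝕜 d)) := by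
  rw [indTopology, isClosed_iSup_iff]
  exact forall_congr' fun d => isClosed_coinduced

/-! (1) Write `K[x₁,…,xₙ] = R[X]` with `X = x₁` and `R = K[x₂,…,xₙ]`. A triangular automorphism
preserves `R`, is triangular there, and sends `X` to `aX + p`. Solvability follows by induction on
`n`: the triangular automorphisms fixing `R` have an abelian subgroup of shifts `X ↦ X + p`, the
kernel of the character `a`. For maximality, let `G` be solvable and contain the triangular group.
Its last nontrivial derived subgroup `A` is abelian and normal, so every `φ ∈ A` commutes with its
conjugates by the shifts `X ↦ X + tp`. To first order in `t` this reads `φ²D - 2φDφ + Dφ² = 0` with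
`D = p·d/dX`, and varying `p` forces `φ` to be a shift (`exists_eq_shiftEquiv`). The invariants of a
nontrivial shift are exactly `R`, so normality of `A` makes `G` preserve `R`
(`map_C_of_isSolvable`), and induction applies to the restriction to `R`.

(2) Triangularity in the plane is the vanishing of one partial derivative, a closed condition. If a
closed `H` contains the triangular group and a further `f`, translations move a point where that
derivative is nonzero, and its image, to the origin. Conjugating by homotheties and letting the
ratio tend to `0` puts the linear part in `H` (`mem_of_linear_part`). By the Bruhat decomposition
`H` contains the swap, and by Jung's theorem (`eq_top_of_jonquieres_le`) it is everything. Jung's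
theorem is proved by degree reduction: a component `G` of `f⁻¹` satisfies `G(f) = xᵢ`, so the
leading forms of `f` satisfy a relation. Taking Jacobians with `f₀` shows that many derivatives of
this relation vanish too. A sparse polynomial cannot have such a multiple root, so one degree
divides the other, and then one leading form is a multiple of a power of the other.

(3) The triangular group is enlarged by an involution `f` of high degree, conjugate to the swap,
chosen so that in a product alternating between `f` and nontrivial triangular maps every `f` raises
the degree (`firstTerm_lt_secondTerm_mul`). Such products are either triangular or of degree at
least `2` in the second component, so the swap is missed. -/

open scoped Polynomial

/-! ### First-order expansions in a parameter -/

section Jets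

variable {K S : Type*} [Field K] [CommRing S] [Algebra K S]

/-- `F` is a polynomial function of the parameter, with constant term `a` and linear
coefficient `b`. -/
def HasJet (F : K → S) (a b : S) : Prop :=
  ∃ P : S[X], (∀ t, F t = P.eval (algebraMap K S t)) ∧ P.coeff 0 = a ∧ P.coeff 1 = b

theorem HasJet.const (a : S) : HasJet (fun _ : K => a) a 0 :=
  ⟨Polynomial.C a, fun t => by simp, by simp, by simp⟩

theorem HasJet.add {F G : K → S} {a b c d : S} (hF : HasJet F a b) (hG : HasJet G c d) :
    HasJet (fun t => F t + G t) (a + c) (b + d) := by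
  obtain ⟨P, hP, rfl, rfl⟩ := hF
  obtain ⟨Q, hQ, rfl, rfl⟩ := hG
  exact ⟨P + Q, fun t => by simp [hP, hQ], by simp, by simp⟩

theorem HasJet.mul {F G : K → S} {a b c d : S} (hF : HasJet F a b) (hG : HasJet G c d) :
    HasJet (fun t => F t * G t) (a * c) (a * d + b * c) := by
  obtain ⟨P, hP, rfl, rfl⟩ := hF
  obtain ⟨Q, hQ, rfl, rfl⟩ := hG
  exact ⟨P * Q, fun t => by simp [hP, hQ], by simp [Polynomial.mul_coeff_zero],
    by simp [Polynomial.mul_coeff_one]⟩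

theorem HasJet.map {F : K → S} {a b : S} (hF : HasJet F a b) (φ : S →ₐ[K] S) :
    HasJet (fun t => φ (F t)) (φ a) (φ b) := by
  obtain ⟨P, hP, rfl, rfl⟩ := hF
  refine ⟨P.map (φ : S →+* S), fun t => ?_, by simp, by simp⟩
  have := Polynomial.eval₂_at_apply (p := P) (φ : S →+* S) (algebraMap K S t)
  rw [← Polynomial.eval_map] at this
  simpa [hP] using this.symm

/-- A polynomial over a domain is determined by its values on the infinite set `K`, so first-order
terms of an identity in `t` can be compared. -/
theorem HasJet.unique [IsDomain S] [Infinite K] {F : K → S} {a b c d : S}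
    (h : HasJet F a b) (h' : HasJet F c d) : b = d := by
  obtain ⟨P, hP, rfl, rfl⟩ := h
  obtain ⟨Q, hQ, rfl, rfl⟩ := h'
  have : P = Q := by
    refine Polynomial.eq_of_infinite_eval_eq P Q ?_
    refine (Set.infinite_range_of_injective
      (FaithfulSMul.algebraMap_injective K S)).mono ?_
    rintro _ ⟨t, rfl⟩
    exact (hP t).symm.trans (hQ t)
  rw [this]

/-- Leibniz rule for a moving operator: if `σ_t = 1 + tδ + ⋯` and `F(t) = a + tb + ⋯`, then `σ_t
F(t) = a + t(b + δa) + ⋯`. By additivity it suffices to treat `F(t) = s tⁿ`. -/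
theorem HasJet.comp {σ : K → S →ₐ[K] S} {δ : S →+ S}
    (hσ : ∀ s, HasJet (fun t => σ t s) s (δ s)) {F : K → S} {a b : S} (hF : HasJet F a b) :
    HasJet (fun t => σ t (F t)) a (b + δ a) := by
  obtain ⟨P, hP, rfl, rfl⟩ := hF
  simp only [hP]
  clear hP
  induction P using Polynomial.induction_on' with
  | add p q hp hq =>
    have := hp.add hq
    simp only [Polynomial.eval_add, map_add, Polynomial.coeff_add]
    convert! this using 1
    abel
  | monomial n s =>
    have h1 : HasJet (fun t : K => algebraMap K S t ^ n) ((Polynomial.X ^ n : S[X]).coeff 0)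
        ((Polynomial.X ^ n : S[X]).coeff 1) := ⟨Polynomial.X ^ n, fun t => by simp, rfl, rfl⟩
    have h2 := (hσ s).mul h1
    simp only [Polynomial.eval_monomial, map_mul, map_pow, AlgHom.commutes]
    convert! h2 using 1
    · rcases n with _ | n <;> simp [Polynomial.coeff_monomial]
    · rcases n with _ | _ | n <;> simp [Polynomial.coeff_monomial, Polynomial.coeff_X_pow,
        Polynomial.coeff_one]

end Jets

/-! ### The shifts of `R[X]` -/

section Shift

variable (K : Type*) {R : Type*} [Field K] [CommRing R] [Algebra K R]

/-- The automorphism `X ↦ X + p` of `R[X]`. -/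
noncomputable def shiftEquiv (p : R) : R[X] ≃ₐ[K] R[X] :=
  (Polynomial.algEquivAevalXAddC p).restrictScalars K

@[simp] theorem shiftEquiv_C (p r : R) :
    shiftEquiv K p (Polynomial.C r) = Polynomial.C r := by
  simp [shiftEquiv]

@[simp] theorem shiftEquiv_X (p : R) :
    shiftEquiv K p Polynomial.X = Polynomial.X + Polynomial.C p := by
  simp [shiftEquiv]

theorem shiftEquiv_apply (p : R) (h : R[X]) :
    shiftEquiv K p h = h.comp (Polynomial.X + Polynomial.C p) := by
  simp [shiftEquiv, Polynomial.comp, Polynomial.aeval_def]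

/-- Automorphisms of `R[X]` agreeing on constants and on `X` are equal. -/
theorem algEquiv_polynomial_ext {φ ψ : R[X] ≃ₐ[K] R[X]}
    (hC : ∀ r, φ (Polynomial.C r) = ψ (Polynomial.C r)) (hX : φ Polynomial.X = ψ Polynomial.X) :
    φ = ψ := by
  ext h
  induction h using Polynomial.induction_on' with
  | add p q hp hq => simp [hp, hq]
  | monomial n a => simp [← Polynomial.C_mul_X_pow_eq_monomial, hC, hX]

theorem shiftEquiv_add (p q : R) : shiftEquiv K (p + q) = shiftEquiv K p * shiftEquiv K q := by
  refine algEquiv_polynomial_ext K (fun r => by simp) ?_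
  simp [add_assoc]

@[simp] theorem shiftEquiv_zero : shiftEquiv K (0 : R) = 1 :=
  algEquiv_polynomial_ext K (fun r => by simp) (by simp)

theorem shiftEquiv_neg (p : R) : shiftEquiv K (-p) = (shiftEquiv K p)⁻¹ := by
  rw [eq_inv_iff_mul_eq_one, ← shiftEquiv_add]
  simp

/-- The derivation `p · d/dX`. -/
noncomputable def shiftDeriv (p : R) : R[X] →+ R[X] :=
  (AddMonoidHom.mulLeft (Polynomial.C p)).comp Polynomial.derivative.toAddMonoidHom

@[simp] theorem shiftDeriv_apply (p : R) (h : R[X]) :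
    shiftDeriv p h = Polynomial.C p * Polynomial.derivative h := rfl

/-- Taylor's formula `h(X + tp) = h + t p h' + ⋯`, obtained on monomials from the product rule for
jets. -/
theorem hasJet_shiftEquiv (p : R) (h : R[X]) :
    HasJet (fun t : K => shiftEquiv K (t • p) h) h (shiftDeriv p h) := by
  have hX : HasJet (fun t : K => shiftEquiv K (t • p) (Polynomial.X : R[X])) Polynomial.X
      (Polynomial.C p) := by
    refine ⟨Polynomial.C Polynomial.X + Polynomial.C (Polynomial.C p) * Polynomial.X,
      fun t => ?_, by simp, by simp [Polynomial.coeff_C]⟩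
    beta_reduce
    rw [shiftEquiv_X, Algebra.smul_def, Polynomial.C_mul, Polynomial.eval_add,
      Polynomial.eval_C, Polynomial.eval_mul, Polynomial.eval_C, Polynomial.eval_X,
      Polynomial.algebraMap_apply, mul_comm]
  induction h using Polynomial.induction_on with
  | C a => simpa using HasJet.const (K := K) (Polynomial.C a)
  | add p q hp hq => simpa [mul_add] using hp.add hq
  | monomial n a h =>
    have e : shiftDeriv p (Polynomial.C a * Polynomial.X ^ (n + 1)) =
        Polynomial.C a * Polynomial.X ^ n * Polynomial.C p +
          shiftDeriv p (Polynomial.C a * Polynomial.X ^ n) * Polynomial.X := by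
      rw [pow_succ, ← mul_assoc, shiftDeriv_apply, shiftDeriv_apply, Polynomial.derivative_mul,
        Polynomial.derivative_X]
      ring
    have := h.mul hX
    simp only [← map_mul] at this
    rw [e, pow_succ, ← mul_assoc]
    exact this

end Shift

/-! ### Solvable groups containing all shifts -/

section Centralizer

variable {K R : Type*} [Field K] [CharZero K] [CommRing R] [IsDomain R] [Algebra K R]

/-- First-order consequence of the commutation of `φ` with all `σ φ σ⁻¹`, where `σ` runs through
a one-parameter group of shifts. -/
theorem jet_commutation (φ : R[X] ≃ₐ[K] R[X]) (p : R)
    (hφ : ∀ t : K, Commute φ (shiftEquiv K (t • p) * φ * (shiftEquiv K (t • p))⁻¹)) (h : R[X]) :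
    φ (φ (shiftDeriv p h)) - 2 * φ (shiftDeriv p (φ h)) + shiftDeriv p (φ (φ h)) = 0 := by
  have hp := fun s => hasJet_shiftEquiv K p s
  have hn : ∀ s, HasJet (fun t : K => ((shiftEquiv K (t • p))⁻¹ : R[X] ≃ₐ[K] R[X]) s) s
      (shiftDeriv (-p) s) := by
    intro s
    simpa only [← shiftEquiv_neg, smul_neg] using hasJet_shiftEquiv K (-p) s
  -- `e1` and `e2` expand the two sides of `φ σ φ σ⁻¹ h = σ φ σ⁻¹ φ h` to first order in `t`.
  have e1 := ((HasJet.comp (σ := fun t : K => (shiftEquiv K (t • p) : R[X] →ₐ[K] R[X]))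
    (δ := shiftDeriv p) hp ((hn h).map (φ : R[X] →ₐ[K] R[X])))).map (φ : R[X] →ₐ[K] R[X])
  have e2 := HasJet.comp (σ := fun t : K => (shiftEquiv K (t • p) : R[X] →ₐ[K] R[X]))
    (δ := shiftDeriv p) hp ((hn (φ h)).map (φ : R[X] →ₐ[K] R[X]))
  have e3 : ∀ t : K, φ (shiftEquiv K (t • p) (φ ((shiftEquiv K (t • p))⁻¹ h))) =
      shiftEquiv K (t • p) (φ ((shiftEquiv K (t • p))⁻¹ (φ h))) := fun t =>
    DFunLike.congr_fun (hφ t) h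
  have e4 := e1.unique (by simpa only [AlgEquiv.coe_toAlgHom, e3] using e2)
  simp only [shiftDeriv_apply, AlgEquiv.coe_toAlgHom, map_add, map_mul, map_neg, neg_mul] at e4 ⊢
  linear_combination (-1) * e4

omit [CharZero K] in
/-- If `g ∘ d/dX ∘ g⁻¹` kills the constants, then it is a scalar multiple of `d/dX`. -/
theorem conj_derivative_eq (hunit : ∀ u : R, IsUnit u → ∃ c : K, u = algebraMap K R c)
    (g : R[X] ≃ₐ[K] R[X])
    (hg : ∀ r : R, Polynomial.derivative (g.symm (Polynomial.C r)) = 0) :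
    ∃ c : K, c ≠ 0 ∧ ∀ k : R[X], g (Polynomial.derivative (g.symm k)) =
      algebraMap K R[X] c * Polynomial.derivative k := by
  -- The conjugated derivation kills `R`, hence is `R`-linear and determined by its value at `X`.
  have hD : ∀ k : R[X], g (Polynomial.derivative (g.symm k)) =
      g (Polynomial.derivative (g.symm Polynomial.X)) * Polynomial.derivative k := by
    intro k
    induction k using Polynomial.induction_on with
    | C a => simp [hg]
    | add p q hp hq => simp [hp, hq, mul_add]
    | monomial n a h =>
      have e : g (Polynomial.derivative (g.symm (Polynomial.C a * Polynomial.X ^ n *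
          Polynomial.X))) = g (Polynomial.derivative (g.symm (Polynomial.C a * Polynomial.X ^ n))) *
          Polynomial.X + Polynomial.C a * Polynomial.X ^ n *
            g (Polynomial.derivative (g.symm Polynomial.X)) := by
        rw [map_mul g.symm (Polynomial.C a * Polynomial.X ^ n), Polynomial.derivative_mul, map_add,
          map_mul g, map_mul g, g.apply_symm_apply, g.apply_symm_apply]
      rw [pow_succ, ← mul_assoc, e, h, Polynomial.derivative_mul (g := Polynomial.X),
        Polynomial.derivative_X]
      ring
  -- At `k = g X` the left side is `1`, so the value at `X` is a unit of `R[X]`, and units are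
  -- scalars.
  have h1 := hD (g Polynomial.X)
  rw [g.symm_apply_apply, Polynomial.derivative_X, map_one] at h1
  obtain ⟨r, hr, hrc⟩ := Polynomial.isUnit_iff.1 (IsUnit.of_mul_eq_one _ h1.symm)
  obtain ⟨c, rfl⟩ := hunit r hr
  refine ⟨c, ?_, fun k => ?_⟩
  · rintro rfl
    simp at hr
  · rw [hD k, ← hrc, Polynomial.algebraMap_apply]

/-- An automorphism of `R[X]` commuting with all its conjugates by shifts is a shift. -/
theorem exists_eq_shiftEquiv (hunit : ∀ u : R, IsUnit u → ∃ c : K, u = algebraMap K R c)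
    (φ : R[X] ≃ₐ[K] R[X])
    (hφ : ∀ p : R, Commute φ (shiftEquiv K p * φ * (shiftEquiv K p)⁻¹)) :
    ∃ q, φ = shiftEquiv K q := by
  have hchar : CharZero R :=
    charZero_of_injective_algebraMap (FaithfulSMul.algebraMap_injective K R)
  -- The jet identity at `h = φ⁻² k`; the case `p = 1` is `key1`.
  have key : ∀ p k, φ (φ (Polynomial.C p)) * φ (φ (Polynomial.derivative (φ.symm (φ.symm k)))) -
      2 * (φ (Polynomial.C p) * φ (Polynomial.derivative (φ.symm k))) +
      Polynomial.C p * Polynomial.derivative k = 0 := by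
    intro p k
    simpa using jet_commutation φ p (fun t => hφ _) (φ.symm (φ.symm k))
  have key1 : ∀ k, φ (φ (Polynomial.derivative (φ.symm (φ.symm k)))) -
      2 * φ (Polynomial.derivative (φ.symm k)) + Polynomial.derivative k = 0 := by
    intro k
    simpa using key 1 k
  have hkill : ∀ r, φ (Polynomial.derivative (φ.symm (Polynomial.C r))) = 0 := by
    intro r
    by_contra hr
    -- On a constant `k = r` the last terms vanish, and `key - φ²(p)·key1` leaves `2(φ²p -
    -- φp)·φ(∂φ⁻¹r) = 0`. A nonzero last factor would force `φ` to fix `R`, and then `∂φ⁻¹r = ∂r =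
    -- 0`.
    have hfix : ∀ p, φ (Polynomial.C p) = Polynomial.C p := by
      intro p
      have e1 := key p (Polynomial.C r)
      have e2 := key1 (Polynomial.C r)
      rw [Polynomial.derivative_C] at e1 e2
      have e3 : (φ (φ (Polynomial.C p)) - φ (Polynomial.C p)) *
          (2 * φ (Polynomial.derivative (φ.symm (Polynomial.C r)))) = 0 := by
        linear_combination e1 - φ (φ (Polynomial.C p)) * e2
      have e4 := (mul_eq_zero.1 e3).resolve_right (mul_ne_zero two_ne_zero hr)
      exact φ.injective (sub_eq_zero.1 e4)
    apply hr
    rw [φ.symm_apply_eq.2 (hfix r).symm, Polynomial.derivative_C, map_zero]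
  have hkill' : ∀ r, Polynomial.derivative (φ.symm (Polynomial.C r)) = 0 := fun r =>
    (map_eq_zero_iff φ φ.injective).1 (hkill r)
  obtain ⟨c, hc0, hc⟩ := conj_derivative_eq hunit φ hkill'
  have hcc : ∀ k, φ (φ (Polynomial.derivative (φ.symm (φ.symm k)))) =
      algebraMap K R[X] (c * c) * Polynomial.derivative k := by
    intro k
    rw [hc (φ.symm k), map_mul, AlgEquiv.commutes, hc, map_mul, mul_assoc]
  -- With `φ∂φ⁻¹ = c∂`, the identity `key1` becomes `c² - 2c + 1 = 0`.
  have hc1 : c = 1 := by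
    have := key1 Polynomial.X
    rw [hcc, hc, Polynomial.derivative_X] at this
    have h2 : algebraMap K R[X] ((c - 1) * (c - 1)) = 0 := by
      simp only [map_mul, map_sub, map_one] at this ⊢
      linear_combination this
    have h3 := (map_eq_zero_iff _ (FaithfulSMul.algebraMap_injective K R[X])).1 h2
    exact sub_eq_zero.1 (mul_self_eq_zero.1 h3)
  subst hc1
  have hquad : ∀ p, φ (φ (Polynomial.C p)) - 2 * φ (Polynomial.C p) + Polynomial.C p = 0 := by
    intro p
    have := key p Polynomial.X
    rw [hcc, hc] at this
    simpa using this
  have hfix : ∀ p, φ (Polynomial.C p) = Polynomial.C p := by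
    intro p
    -- Since `φ² - 2φ + 1` vanishes at both `p` and `p²`, multiplicativity of `φ` gives `2(φp - p)²
    -- = 0`.
    have e1 := hquad p
    have e2 := hquad (p * p)
    simp only [map_mul] at e2
    have e3 : 2 * ((φ (Polynomial.C p) - Polynomial.C p) *
        (φ (Polynomial.C p) - Polynomial.C p)) = 0 := by
      linear_combination e2 - (φ (φ (Polynomial.C p)) + 2 * φ (Polynomial.C p) -
        Polynomial.C p) * e1
    exact sub_eq_zero.1 (mul_self_eq_zero.1 ((mul_eq_zero.1 e3).resolve_left two_ne_zero))
  have hX : Polynomial.derivative (φ Polynomial.X - Polynomial.X) = 0 := by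
    have := hc (φ Polynomial.X)
    simp only [φ.symm_apply_apply, Polynomial.derivative_X, map_one, one_mul] at this
    rw [Polynomial.derivative_sub, ← this, Polynomial.derivative_X, sub_self]
  obtain ⟨q, hq⟩ : ∃ q, φ Polynomial.X - Polynomial.X = Polynomial.C q :=
    ⟨_, Polynomial.eq_C_of_derivative_eq_zero hX⟩
  refine ⟨q, algEquiv_polynomial_ext K (fun r => by simp [hfix]) ?_⟩
  rw [shiftEquiv_X, ← hq]
  ring

/-- The invariants of a nontrivial shift are the constants. -/
theorem exists_eq_C_of_shiftEquiv_eq {q : R} (hq : q ≠ 0) {h : R[X]}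
    (hh : shiftEquiv K q h = h) : ∃ r, h = Polynomial.C r := by
  have : CharZero R := charZero_of_injective_algebraMap (FaithfulSMul.algebraMap_injective K R)
  -- Invariance makes `h` take the value `h(0)` at every multiple `kq`, and these are infinitely
  -- many in characteristic zero.
  have hk : ∀ k : ℕ, h.eval ((k : R) * q) = h.eval 0 := by
    intro k
    induction k with
    | zero => simp
    | succ k ih =>
      rw [← ih]
      nth_rewrite 2 [← hh]
      rw [shiftEquiv_apply, Polynomial.eval_comp]
      simp [add_mul]
  refine ⟨h.eval 0, Polynomial.eq_of_infinite_eval_eq _ _ ?_⟩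
  refine (Set.infinite_range_of_injective (f := fun k : ℕ => (k : R) * q) ?_).mono ?_
  · intro a b hab
    exact Nat.cast_injective (mul_right_cancel₀ hq hab)
  · rintro _ ⟨k, rfl⟩
    simp [hk]

/-- A solvable group of automorphisms of `R[X]` that contains all shifts preserves `R`. -/
theorem map_C_of_isSolvable (hunit : ∀ u : R, IsUnit u → ∃ c : K, u = algebraMap K R c)
    (G : Subgroup (R[X] ≃ₐ[K] R[X])) (hG : Group.IsSolvable G)
    (hs : ∀ p, shiftEquiv K p ∈ G) {g : R[X] ≃ₐ[K] R[X]} (hg : g ∈ G) (r : R) :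
    ∃ r', g (Polynomial.C r) = Polynomial.C r' := by
  classical
  have hex := hG.solvable
  -- The derived length is positive because the shift by `1` is nontrivial; `derivedSeries G k` is
  -- then the last nontrivial term.
  obtain ⟨k, hk⟩ : ∃ k, Nat.find hex = k + 1 := by
    refine Nat.exists_eq_succ_of_ne_zero fun h0 => ?_
    have := Nat.find_spec hex
    rw [h0, derivedSeries_zero] at this
    have h1 : (⟨shiftEquiv K 1, hs 1⟩ : G) ∈ (⊤ : Subgroup G) := trivial
    rw [this, Subgroup.mem_bot, Subtype.ext_iff] at h1
    have := DFunLike.congr_fun h1 (Polynomial.X : R[X])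
    simp at this
  have hbot : derivedSeries G (k + 1) = ⊥ := hk ▸ Nat.find_spec hex
  have hne : derivedSeries G k ≠ ⊥ := Nat.find_min hex (by omega)
  have hcomm : ∀ a ∈ derivedSeries G k, ∀ b ∈ derivedSeries G k, a * b = b * a := by
    intro a ha b hb
    rw [derivedSeries_succ] at hbot
    have := Subgroup.commutator_mem_commutator ha hb
    rw [hbot, Subgroup.mem_bot] at this
    exact commutatorElement_eq_one_iff_mul_comm.1 this
  have hshift : ∀ a ∈ derivedSeries G k, ∃ q, (a : R[X] ≃ₐ[K] R[X]) = shiftEquiv K q := by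
    intro a ha
    refine exists_eq_shiftEquiv hunit _ fun p => ?_
    have hn : (derivedSeries G k).Normal := inferInstance
    exact congrArg Subtype.val (hcomm a ha _ (hn.conj_mem a ha ⟨shiftEquiv K p, hs p⟩))
  obtain ⟨⟨a, ha⟩, hx⟩ := Subgroup.ne_bot_iff_exists_ne_one.1 hne
  have ha1 : a ≠ 1 := fun h => hx (Subtype.ext h)
  obtain ⟨q, hq⟩ := hshift a ha
  have hq0 : q ≠ 0 := by
    rintro rfl
    exact ha1 (Subtype.ext (by simpa using hq))
  refine exists_eq_C_of_shiftEquiv_eq (K := K) hq0 ?_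
  have hn : (derivedSeries G k).Normal := inferInstance
  -- By normality `g⁻¹ a g` is again a shift, so it fixes `r`; hence `g r` is invariant under the
  -- nontrivial shift `a`.
  obtain ⟨q', hq'⟩ := hshift _ (hn.conj_mem a ha ⟨g, hg⟩⁻¹)
  have := DFunLike.congr_fun hq' (Polynomial.C r)
  simp only [shiftEquiv_C, inv_inv, Subgroup.coe_mul, InvMemClass.coe_inv, AlgEquiv.mul_apply,
    hq] at this
  exact (g.symm_apply_eq).1 this

/-- A group of automorphisms of `R[X]` preserving `R` acts on `X` by affine maps. -/
theorem map_X_of_map_C (hunit : ∀ u : R, IsUnit u → ∃ c : K, u = algebraMap K R c)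
    (g : R[X] ≃ₐ[K] R[X]) (hg : ∀ r, ∃ r', g.symm (Polynomial.C r) = Polynomial.C r') :
    ∃ c : K, c ≠ 0 ∧ ∃ p : R, g Polynomial.X =
      Polynomial.C (algebraMap K R c) * Polynomial.X + Polynomial.C p := by
  obtain ⟨c, hc0, hc⟩ := conj_derivative_eq hunit g (fun r => by
    obtain ⟨r', hr'⟩ := hg r
    rw [hr', Polynomial.derivative_C])
  have h1 := hc (g Polynomial.X)
  rw [g.symm_apply_apply, Polynomial.derivative_X, map_one] at h1
  have h2 : Polynomial.derivative (g Polynomial.X -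
      Polynomial.C (algebraMap K R c⁻¹) * Polynomial.X) = 0 := by
    have h3 : algebraMap K R[X] c⁻¹ * algebraMap K R[X] c = 1 := by
      rw [← map_mul, inv_mul_cancel₀ hc0, map_one]
    rw [Polynomial.derivative_sub, Polynomial.derivative_C_mul, Polynomial.derivative_X,
      ← Polynomial.algebraMap_apply]
    linear_combination (Polynomial.derivative (g Polynomial.X)) * (-h3) -
      algebraMap K R[X] c⁻¹ * h1
  have : CharZero R := charZero_of_injective_algebraMap (FaithfulSMul.algebraMap_injective K R)
  obtain ⟨p, hp⟩ : ∃ p, g Polynomial.X - Polynomial.C (algebraMap K R c⁻¹) * Polynomial.X =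
    Polynomial.C p := ⟨_, Polynomial.eq_C_of_derivative_eq_zero h2⟩
  exact ⟨c⁻¹, inv_ne_zero hc0, p, by rw [← hp]; ring⟩

end Centralizer

/-! ### Restriction to the coefficient ring and solvability -/

section Restriction

variable {K R : Type*} [Field K] [CommRing R] [Algebra K R]

/-- The endomorphism of `R` induced by an endomorphism of `R[X]` and `X ↦ 0`. -/
noncomputable def constRestrict (g : R[X] →ₐ[K] R[X]) : R →ₐ[K] R :=
  ((Polynomial.aeval (0 : R)).restrictScalars K).comp (g.comp Polynomial.CAlgHom)

theorem C_constRestrict {g : R[X] →ₐ[K] R[X]} {r : R}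
    (hg : ∃ r', g (Polynomial.C r) = Polynomial.C r') :
    Polynomial.C (constRestrict g r) = g (Polynomial.C r) := by
  obtain ⟨r', hr'⟩ := hg
  simp [constRestrict, hr']

/-- Restriction to `R` for a group of automorphisms of `R[X]` preserving `R`. -/
noncomputable def restrictHom (G : Subgroup (R[X] ≃ₐ[K] R[X]))
    (hG : ∀ g ∈ G, ∀ r, ∃ r', g (Polynomial.C r) = Polynomial.C r') : G →* (R ≃ₐ[K] R) where
  toFun g := AlgEquiv.ofAlgHom (constRestrict (g : R[X] ≃ₐ[K] R[X]))
    (constRestrict (((g⁻¹ : G) : R[X] ≃ₐ[K] R[X]) : R[X] →ₐ[K] R[X]))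
    (by
      ext r
      apply Polynomial.C_injective
      rw [AlgHom.comp_apply, C_constRestrict (hG _ g.2 _), C_constRestrict (hG _ (g⁻¹).2 _)]
      exact g.1.apply_symm_apply _)
    (by
      ext r
      apply Polynomial.C_injective
      rw [AlgHom.comp_apply, C_constRestrict (hG _ (g⁻¹).2 _), C_constRestrict (hG _ g.2 _)]
      exact g.1.symm_apply_apply _)
  map_one' := by
    ext r
    apply Polynomial.C_injective
    exact C_constRestrict (hG _ (1 : G).2 _)
  map_mul' g h := by
    ext r
    apply Polynomial.C_injective
    refine (C_constRestrict (hG _ (g * h).2 _)).trans ?_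
    refine Eq.trans ?_ (C_constRestrict (hG _ g.2 _)).symm
    exact congrArg g.1 (show h.1 (Polynomial.C r) =
      Polynomial.C (constRestrict (h.1 : R[X] →ₐ[K] R[X]) r) from
        (C_constRestrict (g := (h.1 : R[X] →ₐ[K] R[X])) (hG _ h.2 r)).symm)

theorem C_restrictHom (G : Subgroup (R[X] ≃ₐ[K] R[X]))
    (hG : ∀ g ∈ G, ∀ r, ∃ r', g (Polynomial.C r) = Polynomial.C r') (g : G) (r : R) :
    Polynomial.C (restrictHom G hG g r) = (g : R[X] ≃ₐ[K] R[X]) (Polynomial.C r) :=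
  C_constRestrict (hG _ g.2 _)

/-- A group of automorphisms of `R[X]` that fixes `R` and acts on `X` by affine maps is
solvable. -/
theorem isSolvable_of_fix_C (G : Subgroup (R[X] ≃ₐ[K] R[X]))
    (hC : ∀ g ∈ G, ∀ r, g (Polynomial.C r) = Polynomial.C r)
    (hX : ∀ g ∈ G, ∃ a p : R, g Polynomial.X = Polynomial.C a * Polynomial.X + Polynomial.C p) :
    Group.IsSolvable G := by
  -- Multiplicative because elements of `G` fix the coefficients in `R`. Its kernel consists of
  -- shifts, which commute.
  let χ : G →* R :=
    { toFun := fun g => ((g : R[X] ≃ₐ[K] R[X]) Polynomial.X).coeff 1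
      map_one' := by simp
      map_mul' := by
        rintro ⟨g, hg⟩ ⟨h, hh⟩
        obtain ⟨a, p, hap⟩ := hX g hg
        obtain ⟨b, q, hbq⟩ := hX h hh
        change (g (h Polynomial.X)).coeff 1 = (g Polynomial.X).coeff 1 * (h Polynomial.X).coeff 1
        rw [hbq, map_add, map_mul, hC g hg, hC g hg, hap]
        simp only [Polynomial.coeff_add, Polynomial.coeff_C_mul, Polynomial.coeff_X_one,
          Polynomial.coeff_C_succ]
        ring }
  have hker : Group.IsSolvable χ.toHomUnits.ker := by
    refine Group.isSolvable_of_comm ?_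
    have hform : ∀ g : χ.toHomUnits.ker, ∃ p : R,
        (g : R[X] ≃ₐ[K] R[X]) Polynomial.X = Polynomial.X + Polynomial.C p := by
      rintro ⟨⟨g, hg⟩, hg'⟩
      obtain ⟨a, p, hap⟩ := hX g hg
      have : χ ⟨g, hg⟩ = 1 := congrArg Units.val hg'
      have ha : a = 1 := by simpa [χ, hap] using this
      exact ⟨p, by simp [hap, ha]⟩
    intro g h
    obtain ⟨p, hp⟩ := hform g
    obtain ⟨q, hq⟩ := hform h
    refine Subtype.ext (Subtype.ext (algEquiv_polynomial_ext K (fun r => ?_) ?_))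
    · simp [hC _ g.1.2, hC _ h.1.2]
    · simp [hC _ g.1.2, hC _ h.1.2, hp, hq, add_right_comm]
  exact Group.isSolvable_of_ker_le_range χ.toHomUnits.ker.subtype χ.toHomUnits (by simp)

/-- A group of automorphisms of `R[X]` preserving `R` and acting on `X` by affine maps is solvable
as soon as its restriction to `R` is. -/
theorem isSolvable_of_restrictHom (G : Subgroup (R[X] ≃ₐ[K] R[X]))
    (hC : ∀ g ∈ G, ∀ r, ∃ r', g (Polynomial.C r) = Polynomial.C r')
    (hX : ∀ g ∈ G, ∃ a p : R, g Polynomial.X = Polynomial.C a * Polynomial.X + Polynomial.C p)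
    (hR : Group.IsSolvable (restrictHom G hC).range) : Group.IsSolvable G := by
  have hker : Group.IsSolvable ((restrictHom G hC).ker.map G.subtype) := by
    refine isSolvable_of_fix_C _ ?_ ?_
    · rintro _ ⟨g, hg, rfl⟩ r
      refine (C_restrictHom G hC g r).symm.trans ?_
      rw [MonoidHom.mem_ker.1 hg]
      rfl
    · rintro _ ⟨g, -, rfl⟩
      exact hX _ g.2
  have hker' : Group.IsSolvable (restrictHom G hC).ker :=
    Group.isSolvable_of_isSolvable_injective
      (f := ((restrictHom G hC).ker.equivMapOfInjective G.subtype
        G.subtype_injective).toMonoidHom) (MulEquiv.injective _)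
  exact Group.isSolvable_of_ker_le_range (restrictHom G hC).ker.subtype
    (restrictHom G hC).rangeRestrict (by simp [MonoidHom.ker_rangeRestrict])

end Restriction

/-! ### Triangular automorphisms by induction on the number of variables -/

section Triangular

variable {K : Type*} [Field K]

/-- Triangular automorphisms of the polynomial algebra in `n` variables. -/
def IsTriangularEquiv {n : ℕ} (φ : MvPolynomial (Fin n) K ≃ₐ[K] MvPolynomial (Fin n) K) : Prop :=
  ∀ i : Fin n, ∃ a : K, a ≠ 0 ∧ ∃ p ∈ supported K {j : Fin n | i < j}, φ (X i) = C a * X i + p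

theorem map_rename_supported {σ τ : Type*} (f : σ → τ) (s : Set σ) :
    (supported K s).map (rename f : MvPolynomial σ K →ₐ[K] MvPolynomial τ K) =
      supported K (f '' s) := by
  rw [supported, AlgHom.map_adjoin, supported]
  congr 1
  ext
  simp

theorem finSuccEquiv_rename_succ {m : ℕ} (p : MvPolynomial (Fin m) K) :
    finSuccEquiv K m (rename Fin.succ p) = Polynomial.C p := by
  have : (finSuccEquiv K m).toAlgHom.comp (rename Fin.succ) = Polynomial.CAlgHom := by
    ext i : 1
    simp [finSuccEquiv_X_succ]
  exact DFunLike.congr_fun this p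

theorem finSuccEquiv_C' {m : ℕ} (a : K) :
    finSuccEquiv K m (C a) = Polynomial.C (C a) := by
  rw [← finSuccEquiv_rename_succ, rename_C]

/-- The automorphism of `K[x₂, …][x₁]` corresponding to one of `K[x₁, x₂, …]`. -/
noncomputable def succConj (m : ℕ) :
    (MvPolynomial (Fin (m + 1)) K ≃ₐ[K] MvPolynomial (Fin (m + 1)) K) ≃*
      ((MvPolynomial (Fin m) K)[X] ≃ₐ[K] (MvPolynomial (Fin m) K)[X]) :=
  AlgEquiv.autCongr (finSuccEquiv K m)

theorem succConj_X {m : ℕ} (φ : MvPolynomial (Fin (m + 1)) K ≃ₐ[K] MvPolynomial (Fin (m + 1)) K) :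
    succConj m φ Polynomial.X = finSuccEquiv K m (φ (X 0)) := by
  rw [← finSuccEquiv_X_zero]
  exact congrArg (fun p => finSuccEquiv K m (φ p)) ((finSuccEquiv K m).symm_apply_apply _)

theorem succConj_C_X {m : ℕ}
    (φ : MvPolynomial (Fin (m + 1)) K ≃ₐ[K] MvPolynomial (Fin (m + 1)) K) (j : Fin m) :
    succConj m φ (Polynomial.C (X j)) = finSuccEquiv K m (φ (X j.succ)) := by
  rw [← finSuccEquiv_X_succ]
  exact congrArg (fun p => finSuccEquiv K m (φ p)) ((finSuccEquiv K m).symm_apply_apply _)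

theorem exists_rename_iff {m : ℕ} (s : Set (Fin m)) (t : Set (Fin (m + 1))) (h : Fin.succ '' s = t)
    (P : MvPolynomial (Fin (m + 1)) K) :
    P ∈ supported K t ↔ ∃ p ∈ supported K s, rename Fin.succ p = P := by
  rw [← h, ← map_rename_supported]
  rfl

/-- This is what lets both inductions run: under `K[x₁,…] = K[x₂,…][x₁]`, triangularity splits into
an affine condition on `X` and triangularity on the coefficient ring. -/
theorem isTriangularEquiv_succ_iff {m : ℕ}
    (φ : MvPolynomial (Fin (m + 1)) K ≃ₐ[K] MvPolynomial (Fin (m + 1)) K) :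
    IsTriangularEquiv φ ↔
      (∃ a : K, a ≠ 0 ∧ ∃ p, succConj m φ Polynomial.X =
        Polynomial.C (C a) * Polynomial.X + Polynomial.C p) ∧
      ∀ j : Fin m, ∃ a : K, a ≠ 0 ∧ ∃ p ∈ supported K {k : Fin m | j < k},
        succConj m φ (Polynomial.C (X j)) = Polynomial.C (C a * X j + p) := by
  rw [IsTriangularEquiv, Fin.forall_fin_succ]
  have h0 : Fin.succ '' (Set.univ : Set (Fin m)) = {j : Fin (m + 1) | 0 < j} := by
    ext j
    refine Fin.cases ?_ (fun j => ?_) j <;> simp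
  have hj : ∀ i : Fin m, Fin.succ '' {k : Fin m | i < k} = {k : Fin (m + 1) | i.succ < k} := by
    intro i
    ext j
    refine Fin.cases ?_ (fun j => ?_) j <;> simp
  refine and_congr ?_ (forall_congr' fun i => ?_)
  · refine exists_congr fun a => and_congr_right fun _ => ?_
    rw [succConj_X]
    constructor
    · rintro ⟨P, hP, h⟩
      obtain ⟨p, -, rfl⟩ := (exists_rename_iff _ _ h0 P).1 hP
      refine ⟨p, ?_⟩
      rw [h, map_add (finSuccEquiv K m), map_mul (finSuccEquiv K m), finSuccEquiv_C', finSuccEquiv_X_zero,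
        finSuccEquiv_rename_succ]
    · rintro ⟨p, h⟩
      refine ⟨rename Fin.succ p, (exists_rename_iff _ _ h0 _).2 ⟨p, by simp, rfl⟩, ?_⟩
      apply (finSuccEquiv K m).injective
      rw [h, map_add (finSuccEquiv K m), map_mul (finSuccEquiv K m), finSuccEquiv_C', finSuccEquiv_X_zero,
        finSuccEquiv_rename_succ]
  · refine exists_congr fun a => and_congr_right fun _ => ?_
    rw [succConj_C_X]
    constructor
    · rintro ⟨P, hP, h⟩
      obtain ⟨p, hp, rfl⟩ := (exists_rename_iff _ _ (hj i) P).1 hP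
      refine ⟨p, hp, ?_⟩
      rw [h, map_add (finSuccEquiv K m), map_mul (finSuccEquiv K m), finSuccEquiv_C', finSuccEquiv_X_succ,
        finSuccEquiv_rename_succ, Polynomial.C_add, Polynomial.C_mul]
    · rintro ⟨p, hp, h⟩
      refine ⟨rename Fin.succ p, (exists_rename_iff _ _ (hj i) _).2 ⟨p, hp, rfl⟩, ?_⟩
      apply (finSuccEquiv K m).injective
      rw [h, map_add (finSuccEquiv K m), map_mul (finSuccEquiv K m), finSuccEquiv_C', finSuccEquiv_X_succ,
        finSuccEquiv_rename_succ, Polynomial.C_add, Polynomial.C_mul]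

theorem exists_C_of_forall_X {m : ℕ}
    (g : (MvPolynomial (Fin m) K)[X] ≃ₐ[K] (MvPolynomial (Fin m) K)[X])
    (hg : ∀ j, ∃ p, g (Polynomial.C (X j)) = Polynomial.C p) (r : MvPolynomial (Fin m) K) :
    ∃ p, g (Polynomial.C r) = Polynomial.C p := by
  induction r using MvPolynomial.induction_on with
  | C a => exact ⟨C a, g.commutes a⟩
  | add p q hp hq =>
    obtain ⟨p', hp⟩ := hp
    obtain ⟨q', hq⟩ := hq
    exact ⟨p' + q', by simp [hp, hq]⟩
  | mul_X p i hp =>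
    obtain ⟨p', hp⟩ := hp
    obtain ⟨q', hq⟩ := hg i
    exact ⟨p' * q', by simp [hp, hq]⟩

theorem isSolvable_map {G G' : Type*} [Group G] [Group G'] (f : G →* G') (H : Subgroup G)
    (hH : Group.IsSolvable H) : Group.IsSolvable (H.map f) :=
  Group.isSolvable_of_surjective (f.subgroupMap_surjective H)

theorem isSolvable_of_map {G G' : Type*} [Group G] [Group G'] (f : G →* G')
    (hf : Function.Injective f) (H : Subgroup G) (hH : Group.IsSolvable (H.map f)) :
    Group.IsSolvable H :=
  Group.isSolvable_of_isSolvable_injective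
    (f := (H.equivMapOfInjective f hf).toMonoidHom) (MulEquiv.injective _)

/-- Groups of triangular automorphisms are solvable. -/
theorem isSolvable_of_isTriangularEquiv (n : ℕ)
    (G : Subgroup (MvPolynomial (Fin n) K ≃ₐ[K] MvPolynomial (Fin n) K))
    (hG : ∀ g ∈ G, IsTriangularEquiv g) : Group.IsSolvable G := by
  induction n with
  | zero =>
    refine Group.isSolvable_of_comm fun a b => Subtype.ext (AlgEquiv.ext fun p => ?_)
    rw [eq_C_of_isEmpty p]
    exact ((a * b).1.commutes _).trans ((b * a).1.commutes _).symm
  | succ m ih =>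
    refine isSolvable_of_map (succConj m).toMonoidHom (succConj m).injective G ?_
    have hC : ∀ g ∈ G.map (succConj m).toMonoidHom, ∀ r, ∃ r',
        g (Polynomial.C r) = Polynomial.C r' := by
      rintro _ ⟨g, hg, rfl⟩
      refine exists_C_of_forall_X _ fun j => ?_
      obtain ⟨a, -, p, -, h⟩ := ((isTriangularEquiv_succ_iff g).1 (hG g hg)).2 j
      exact ⟨_, h⟩
    refine isSolvable_of_restrictHom _ hC ?_ (ih _ ?_)
    · rintro _ ⟨g, hg, rfl⟩
      obtain ⟨a, -, p, h⟩ := ((isTriangularEquiv_succ_iff g).1 (hG g hg)).1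
      exact ⟨_, p, h⟩
    · rintro _ ⟨⟨_, g, hg, rfl⟩, rfl⟩ j
      obtain ⟨a, ha, p, hp, h⟩ := ((isTriangularEquiv_succ_iff g).1 (hG g hg)).2 j
      refine ⟨a, ha, p, hp, ?_⟩
      apply Polynomial.C_injective
      rw [C_restrictHom]
      exact h

theorem eq_algebraMap_of_isUnit {m : ℕ} (u : MvPolynomial (Fin m) K) (hu : IsUnit u) :
    ∃ c : K, u = algebraMap K (MvPolynomial (Fin m) K) c := by
  obtain ⟨c, -, h⟩ := isUnit_iff_eq_C_of_isReduced.1 hu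
  exact ⟨c, h⟩

/-- A solvable group of automorphisms containing all triangular ones consists of triangular
automorphisms. -/
theorem isTriangularEquiv_of_isSolvable [CharZero K] (n : ℕ)
    (G : Subgroup (MvPolynomial (Fin n) K ≃ₐ[K] MvPolynomial (Fin n) K))
    (hG : Group.IsSolvable G) (htri : ∀ g, IsTriangularEquiv g → g ∈ G) :
    ∀ g ∈ G, IsTriangularEquiv g := by
  induction n with
  | zero => exact fun g _ i => i.elim0
  | succ m ih =>
    set G' := G.map (succConj m).toMonoidHom with hG'
    have hsol : Group.IsSolvable G' := isSolvable_map _ G hG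
    have hmem : ∀ φ, succConj m φ ∈ G' ↔ φ ∈ G := fun φ =>
      Subgroup.mem_map_iff_mem (f := (succConj (K := K) m).toMonoidHom) (succConj m).injective
    have htri' : ∀ ψ, IsTriangularEquiv ((succConj m).symm ψ) → ψ ∈ G' := by
      intro ψ h
      have := (hmem _).2 (htri _ h)
      rwa [MulEquiv.apply_symm_apply] at this
    have hshift : ∀ p, shiftEquiv K p ∈ G' := by
      intro p
      refine htri' _ ((isTriangularEquiv_succ_iff _).2 ⟨⟨1, one_ne_zero, p, ?_⟩, fun j =>
        ⟨1, one_ne_zero, 0, zero_mem _, ?_⟩⟩) <;> rw [MulEquiv.apply_symm_apply] <;> simp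
    have hC : ∀ g ∈ G', ∀ r, ∃ r', g (Polynomial.C r) = Polynomial.C r' := fun g hg =>
      map_C_of_isSolvable eq_algebraMap_of_isUnit G' hsol hshift hg
    have hrange : ∀ ψ ∈ (restrictHom G' hC).range, IsTriangularEquiv ψ := by
      refine ih _ (Group.isSolvable_of_surjective (restrictHom G' hC).rangeRestrict_surjective) ?_
      intro ψ hψ
      -- A triangular automorphism of `R` extends coefficientwise, fixing `X`, to a triangular one
      -- of `R[X]`. So the restricted group again contains all triangular automorphisms.
      refine ⟨⟨Polynomial.mapAlgEquiv ψ, htri' _ ((isTriangularEquiv_succ_iff _).2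
        ⟨⟨1, one_ne_zero, 0, ?_⟩, fun j => ?_⟩)⟩, ?_⟩
      · rw [MulEquiv.apply_symm_apply]
        simp
      · obtain ⟨a, ha, p, hp, h⟩ := hψ j
        refine ⟨a, ha, p, hp, ?_⟩
        rw [MulEquiv.apply_symm_apply, ← h]
        simp
      · ext r : 1
        apply Polynomial.C_injective
        rw [C_restrictHom]
        simp
    intro g hg
    rw [isTriangularEquiv_succ_iff]
    have hg' := (hmem g).2 hg
    refine ⟨?_, fun j => ?_⟩
    · obtain ⟨c, hc, p, h⟩ := map_X_of_map_C eq_algebraMap_of_isUnit (succConj m g)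
        (hC _ (inv_mem hg'))
      exact ⟨c, hc, p, h⟩
    · obtain ⟨a, ha, p, hp, h⟩ := hrange _ ⟨⟨_, hg'⟩, rfl⟩ j
      refine ⟨a, ha, p, hp, ?_⟩
      rw [← h, C_restrictHom]

end Triangular

/-! ### From algebra automorphisms back to `Aut(𝔸ⁿ)` -/

section Jonquieres

variable {K : Type*} [Field K]

/-- The polynomial automorphism `f` of affine space acts on functions by `h ↦ h ∘ f⁻¹`. -/
noncomputable def pullbackEquiv (n : ℕ) :
    PolyAut n K ≃* (MvPolynomial (Fin n) K ≃ₐ[K] MvPolynomial (Fin n) K) where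
  toFun f := AlgEquiv.ofAlgHom (bind₁ (f⁻¹ : PolyAut n K).1.comp) (bind₁ f.1.comp)
    (by
      ext i : 1
      have := congrArg (fun e : PolyEnd n K => e.comp i) f.mul_inv
      rw [AlgHom.comp_apply, bind₁_X_right]
      exact this)
    (by
      ext i : 1
      have := congrArg (fun e : PolyEnd n K => e.comp i) f.inv_mul
      rw [AlgHom.comp_apply, bind₁_X_right]
      exact this)
  invFun φ := ⟨⟨fun i => φ.symm (X i)⟩, ⟨fun i => φ (X i)⟩,
    by
      ext1
      funext i
      have : bind₁ (fun i => φ (X i)) = (φ : MvPolynomial (Fin n) K →ₐ[K] _) := by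
        ext i : 1
        simp
      change bind₁ (fun i => φ (X i)) (φ.symm (X i)) = X i
      rw [this]
      simp,
    by
      ext1
      funext i
      have : bind₁ (fun i => φ.symm (X i)) = (φ.symm : MvPolynomial (Fin n) K →ₐ[K] _) := by
        ext i : 1
        simp
      change bind₁ (fun i => φ.symm (X i)) (φ (X i)) = X i
      rw [this]
      simp⟩
  left_inv f := by
    ext i : 3
    exact bind₁_X_right _ _
  right_inv φ := by
    refine AlgEquiv.coe_toAlgHom_injective ?_
    ext i : 1
    exact bind₁_X_right _ _
  map_mul' f g := by
    refine AlgEquiv.coe_toAlgHom_injective ?_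
    ext i : 1
    change bind₁ (((f * g)⁻¹ : PolyAut n K).1.comp) (X i) =
      bind₁ ((f⁻¹ : PolyAut n K).1.comp) (bind₁ ((g⁻¹ : PolyAut n K).1.comp) (X i))
    rw [mul_inv_rev, bind₁_X_right, bind₁_X_right]
    rfl

theorem pullbackEquiv_inv_X {n : ℕ} (f : PolyAut n K) (i : Fin n) :
    pullbackEquiv n f⁻¹ (X i) = f.1.comp i := by
  change bind₁ _ (X i) = _
  rw [bind₁_X_right, inv_inv]

/-- The action is `h ↦ h ∘ f⁻¹`, so it displays the components of `f⁻¹` rather than of `f`; this is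
harmless because the triangular automorphisms form a group. -/
theorem isTriangularEquiv_pullback_iff {n : ℕ} (f : PolyAut n K) :
    IsTriangularEquiv (pullbackEquiv n f) ↔ f ∈ jonquieres n K := by
  rw [← inv_mem_iff (x := f)]
  conv_lhs => rw [← inv_inv f]
  simp only [IsTriangularEquiv, pullbackEquiv_inv_X]
  rfl

theorem isSolvable_jonquieres (n : ℕ) : Group.IsSolvable (jonquieres n K) := by
  refine isSolvable_of_map (pullbackEquiv n).toMonoidHom (pullbackEquiv n).injective _
    (isSolvable_of_isTriangularEquiv n _ ?_)
  rintro _ ⟨f, hf, rfl⟩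
  exact (isTriangularEquiv_pullback_iff f).2 hf

/-- The triangular subgroup is maximal among solvable subgroups. -/
theorem maximal_isSolvable_jonquieres [CharZero K] (n : ℕ) :
    Maximal (fun H : Subgroup (PolyAut n K) => Group.IsSolvable H) (jonquieres n K) := by
  refine ⟨isSolvable_jonquieres n, fun H hH hle f hf => ?_⟩
  rw [← isTriangularEquiv_pullback_iff]
  refine isTriangularEquiv_of_isSolvable n (H.map (pullbackEquiv n).toMonoidHom)
    (isSolvable_map _ _ hH) (fun g hg => ?_) _ ⟨f, hf, rfl⟩
  obtain ⟨b, rfl⟩ := (pullbackEquiv n).surjective g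
  exact ⟨b, hle ((isTriangularEquiv_pullback_iff b).1 hg), rfl⟩

end Jonquieres

/-! ### Weighted leading forms -/

section LeadingForms

variable {K σ τ : Type*} [Field K]

theorem aeval_eq_sum_of_support_subset {A : Type*} [CommSemiring A] [Algebra K A] [Fintype τ]
    (f : τ → A) (G : MvPolynomial τ K) {s : Finset (τ →₀ ℕ)} (hs : G.support ⊆ s) :
    aeval f G = ∑ d ∈ s, algebraMap K A (coeff d G) * ∏ i, f i ^ d i := by
  rw [aeval_def, eval₂_eq']
  refine Finset.sum_subset hs fun d _ hd => ?_
  rw [notMem_support_iff.1 hd, map_zero, zero_mul]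

/-- `q` is the part of weighted degree `N` of `p`, and `p` has no monomials of weighted degree
greater than `N`. -/
def HasTopForm (w : σ → ℕ) (N : ℕ) (p q : MvPolynomial σ K) : Prop :=
  IsWeightedHomogeneous w q N ∧ ∀ d, N ≤ Finsupp.weight w d → coeff d p = coeff d q

variable {w : σ → ℕ} {N M : ℕ} {p q p' q' : MvPolynomial σ K}

theorem HasTopForm.coeff_of_lt (h : HasTopForm w N p q) {d : σ →₀ ℕ} (hd : N < Finsupp.weight w d) :
    coeff d p = 0 :=
  (h.2 d hd.le).trans (by_contra fun h' => hd.ne' (h.1 h'))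

theorem hasTopForm_weightedHomogeneousComponent (w : σ → ℕ) (p : MvPolynomial σ K)
    (h : weightedTotalDegree w p ≤ N) :
    HasTopForm w N p (weightedHomogeneousComponent w N p) := by
  classical
  refine ⟨weightedHomogeneousComponent_isWeightedHomogeneous _ _, fun d hd => ?_⟩
  rw [coeff_weightedHomogeneousComponent]
  split_ifs with h'
  · rfl
  · by_contra hne
    exact h' (le_antisymm ((MvPolynomial.le_weightedTotalDegree w (mem_support_iff.2 hne)).trans h) hd)

theorem HasTopForm.add (h : HasTopForm w N p q) (h' : HasTopForm w N p' q') : HasTopForm w N (p + p') (q + q') :=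
  ⟨h.1.add h'.1, fun d hd => by rw [coeff_add, coeff_add, h.2 d hd, h'.2 d hd]⟩

theorem HasTopForm.zero : HasTopForm w N (0 : MvPolynomial σ K) 0 :=
  ⟨isWeightedHomogeneous_zero _ _ _, fun _ _ => rfl⟩

theorem HasTopForm.sum {ι : Type*} (s : Finset ι) {f g : ι → MvPolynomial σ K}
    (h : ∀ i ∈ s, HasTopForm w N (f i) (g i)) : HasTopForm w N (∑ i ∈ s, f i) (∑ i ∈ s, g i) := by
  classical
  induction s using Finset.induction_on with
  | empty => simpa using HasTopForm.zero
  | insert a s ha ih =>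
    rw [Finset.sum_insert ha, Finset.sum_insert ha]
    exact (h a (Finset.mem_insert_self a s)).add
      (ih fun i hi => h i (Finset.mem_insert_of_mem hi))

theorem HasTopForm.mul (h : HasTopForm w N p q) (h' : HasTopForm w M p' q') :
    HasTopForm w (N + M) (p * p') (q * q') := by
  classical
  refine ⟨h.1.mul h'.1, fun d hd => ?_⟩
  rw [coeff_mul, coeff_mul]
  refine Finset.sum_congr rfl fun x hx => ?_
  have hxd : x.1 + x.2 = d := by simpa using hx
  rw [← hxd, map_add] at hd
  rcases lt_or_ge (Finsupp.weight w x.1) N with h1 | h1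
  · have h2 : M < Finsupp.weight w x.2 := by omega
    rw [h'.coeff_of_lt h2, ← h'.2 _ h2.le, h'.coeff_of_lt h2, mul_zero, mul_zero]
  · rcases lt_or_ge (Finsupp.weight w x.2) M with h3 | h3
    · have h2 : N < Finsupp.weight w x.1 := by omega
      rw [h.coeff_of_lt h2, ← h.2 _ h2.le, h.coeff_of_lt h2, zero_mul, zero_mul]
    · rw [h.2 _ h1, h'.2 _ h3]

theorem HasTopForm.C (a : K) : HasTopForm w 0 (C a) (C a) :=
  ⟨isWeightedHomogeneous_C _ _, fun _ _ => rfl⟩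

theorem HasTopForm.C_mul (h : HasTopForm w N p q) (a : K) :
    HasTopForm w N (MvPolynomial.C a * p) (MvPolynomial.C a * q) := by
  simpa using (HasTopForm.C (w := w) a).mul h

theorem HasTopForm.neg (h : HasTopForm w N p q) : HasTopForm w N (-p) (-q) := by
  simpa using h.C_mul (-1)

theorem HasTopForm.sub (h : HasTopForm w N p q) (h' : HasTopForm w N p' q') : HasTopForm w N (p - p') (q - q') := by
  simpa [sub_eq_add_neg] using h.add h'.neg

theorem HasTopForm.pow (h : HasTopForm w N p q) (k : ℕ) : HasTopForm w (k * N) (p ^ k) (q ^ k) := by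
  induction k with
  | zero => simpa using HasTopForm.C (w := w) (1 : K)
  | succ k ih =>
    rw [pow_succ, pow_succ, add_mul, one_mul]
    exact ih.mul h

/-- A zero top form encodes weighted degree below `M`; this lets lower-order terms be absorbed when
top forms are added. -/
theorem HasTopForm.of_lt (h : HasTopForm w N p q) (hN : N < M) : HasTopForm w M p 0 :=
  ⟨isWeightedHomogeneous_zero _ _ _, fun _ hd => by
    rw [coeff_zero]
    exact h.coeff_of_lt (hN.trans_le hd)⟩

theorem HasTopForm.prod {ι : Type*} (s : Finset ι) {f g : ι → MvPolynomial σ K} {n : ι → ℕ}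
    (h : ∀ i ∈ s, HasTopForm w (n i) (f i) (g i)) :
    HasTopForm w (∑ i ∈ s, n i) (∏ i ∈ s, f i) (∏ i ∈ s, g i) := by
  classical
  induction s using Finset.induction_on with
  | empty => simpa using HasTopForm.C (w := w) (1 : K)
  | insert a s ha ih =>
    rw [Finset.prod_insert ha, Finset.prod_insert ha, Finset.sum_insert ha]
    exact (h a (Finset.mem_insert_self a s)).mul
      (ih fun i hi => h i (Finset.mem_insert_of_mem hi))

theorem HasTopForm.pderiv {i : σ} (h : HasTopForm w (N + w i) p q) :
    HasTopForm w N (pderiv i p) (pderiv i q) := by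
  classical
  have hw : ∀ d : σ →₀ ℕ, Finsupp.weight w (d + Finsupp.single i 1) =
      Finsupp.weight w d + w i := by
    intro d
    rw [map_add, Finsupp.weight_single, one_smul]
  refine ⟨fun d hd => ?_, fun d hd => ?_⟩
  · rw [coeff_pderiv] at hd
    have := h.1 (left_ne_zero_of_mul hd)
    rw [hw] at this
    omega
  · rw [coeff_pderiv, coeff_pderiv, h.2 _ (by rw [hw]; omega)]

theorem HasTopForm.le_weightedTotalDegree (h : HasTopForm w N p q) (hq : q ≠ 0) :
    N ≤ weightedTotalDegree w p := by
  obtain ⟨d, hd⟩ := exists_coeff_ne_zero hq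
  have hN := h.1 hd
  rw [← hN]
  exact MvPolynomial.le_weightedTotalDegree w (mem_support_iff.2 (by rwa [h.2 d hN.ge]))

theorem HasTopForm.weightedTotalDegree_lt (h : HasTopForm w N p 0) (hN : 0 < N) :
    weightedTotalDegree w p < N := by
  refine (Finset.sup_lt_iff (by simpa using hN)).2 fun d hd => ?_
  by_contra hlt
  exact mem_support_iff.1 hd (by rw [h.2 d (not_lt.1 hlt), coeff_zero])

/-- Top forms are compatible with substitution. -/
theorem HasTopForm.bind₁ [Fintype τ] {v : τ → ℕ} {G G' : MvPolynomial τ K} (h : HasTopForm v N G G')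
    {f F : τ → MvPolynomial σ K} (hf : ∀ i, HasTopForm w (v i) (f i) (F i)) :
    HasTopForm w N (bind₁ f G) (bind₁ F G') := by
  classical
  rw [MvPolynomial.bind₁, aeval_eq_sum_of_support_subset f G (Finset.subset_union_left (s₂ := G'.support)),
    MvPolynomial.bind₁, aeval_eq_sum_of_support_subset F G' (Finset.subset_union_right (s₁ := G.support))]
  refine HasTopForm.sum _ fun d _ => ?_
  have hd : HasTopForm w (Finsupp.weight v d) (∏ i, f i ^ d i) (∏ i, F i ^ d i) := by
    rw [Finsupp.weight_eq_sum]
    exact HasTopForm.prod _ fun i _ => (hf i).pow (d i)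
  rcases lt_trichotomy (Finsupp.weight v d) N with hlt | heq | hgt
  · have : coeff d G' = 0 := by_contra fun h' => hlt.ne (h.1 h')
    rw [this, map_zero, zero_mul]
    exact (hd.C_mul _).of_lt hlt
  · subst heq
    rw [h.2 d le_rfl]
    exact hd.C_mul _
  · rw [← h.2 d hgt.le, h.coeff_of_lt hgt, map_zero, zero_mul, zero_mul]
    exact HasTopForm.zero

end LeadingForms

/-! ### Jacobian determinants and degrees -/

section Jacobian

variable {K σ τ : Type*} [Field K]

theorem derivation_bind₁ [Fintype τ] (D : Derivation K (MvPolynomial σ K) (MvPolynomial σ K))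
    (f : τ → MvPolynomial σ K) (G : MvPolynomial τ K) :
    D (bind₁ f G) = ∑ i, bind₁ f (pderiv i G) * D (f i) := by
  classical
  induction G using MvPolynomial.induction_on with
  | C a => simp [← algebraMap_eq]
  | add p q hp hq => simp [hp, hq, add_mul, Finset.sum_add_distrib]
  | mul_X p i hp =>
    simp only [map_mul, bind₁_X_right, Derivation.leibniz, smul_eq_mul, hp, map_add, pderiv_X,
      add_mul, Finset.sum_add_distrib]
    congr 1
    · rw [Finset.sum_eq_single i]
      · simp
      · intro j _ hj
        simp [hj.symm]
      · simp
    · rw [Finset.mul_sum]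
      exact Finset.sum_congr rfl fun j _ => by ring

/-- The Jacobian determinant of a pair of polynomials in two variables. -/
noncomputable def jac (P Q : MvPolynomial (Fin 2) K) : MvPolynomial (Fin 2) K :=
  pderiv 0 P * pderiv 1 Q - pderiv 1 P * pderiv 0 Q

theorem jac_bind₁_bind₁ (f : Fin 2 → MvPolynomial (Fin 2) K) (G H : MvPolynomial (Fin 2) K) :
    jac (bind₁ f G) (bind₁ f H) = bind₁ f (jac G H) * jac (f 0) (f 1) := by
  simp only [jac, derivation_bind₁, Fin.sum_univ_two, map_sub, map_mul]
  ring

theorem jac_X : jac (X 0) (X 1 : MvPolynomial (Fin 2) K) = 1 := by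
  simp [jac]

/-- For an automorphism `f` the last factor is a nonzero constant, so `jac f₀` acts on `G(f)` as
`∂/∂y` acts on `G`, up to a scalar. -/
theorem jac_bind₁_right (f : Fin 2 → MvPolynomial (Fin 2) K) (G : MvPolynomial (Fin 2) K) :
    jac (f 0) (bind₁ f G) = bind₁ f (pderiv 1 G) * jac (f 0) (f 1) := by
  have := jac_bind₁_bind₁ f (X 0) G
  rw [bind₁_X_right] at this
  rw [this]
  congr 2
  simp [jac]

theorem totalDegree_pderiv_add_one_le {i : σ} {p : MvPolynomial σ K} (h : pderiv i p ≠ 0) :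
    (pderiv i p).totalDegree + 1 ≤ p.totalDegree := by
  classical
  obtain ⟨d, hd, hd'⟩ := Finset.exists_mem_eq_sup _ (support_nonempty.2 h)
    (fun d : σ →₀ ℕ => d.degree)
  have e : (pderiv i p).totalDegree = d.degree := by
    rw [← hd', totalDegree]
    rfl
  rw [mem_support_iff, coeff_pderiv] at hd
  have := le_totalDegree (mem_support_iff.2 (left_ne_zero_of_mul hd))
  have e2 : ((d + Finsupp.single i 1).sum fun _ e => e) = d.degree + 1 := by
    change (d + Finsupp.single i 1).degree = _
    rw [map_add, Finsupp.degree_single]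
  omega

/-- Each nonzero product in the determinant contains two derivatives, each of which lowers the
degree by at least one. -/
theorem totalDegree_jac_add_two_le {P Q : MvPolynomial (Fin 2) K} (h : jac P Q ≠ 0) :
    (jac P Q).totalDegree + 2 ≤ P.totalDegree + Q.totalDegree := by
  have key : ∀ i j : Fin 2, pderiv i P * pderiv j Q = 0 ∨
      (pderiv i P * pderiv j Q).totalDegree + 2 ≤ P.totalDegree + Q.totalDegree := by
    intro i j
    by_cases hi : pderiv i P = 0
    · simp [hi]
    by_cases hj : pderiv j Q = 0
    · simp [hj]
    right
    rw [totalDegree_mul_of_isDomain hi hj]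
    have := totalDegree_pderiv_add_one_le hi
    have := totalDegree_pderiv_add_one_le hj
    omega
  rw [jac] at h ⊢
  rcases key 0 1 with h1 | h1 <;> rcases key 1 0 with h2 | h2
  · simp [h1, h2] at h
  · rw [h1, zero_sub, totalDegree_neg]
    exact h2
  · rw [h2, sub_zero]
    exact h1
  · have := totalDegree_sub (pderiv 0 P * pderiv 1 Q) (pderiv 1 P * pderiv 0 Q)
    rcases le_max_iff.1 this with h3 | h3 <;> omega

end Jacobian

/-! ### Root multiplicities of sparse polynomials -/

section Sparse

variable {K : Type*} [Field K] [CharZero K]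

/-- A nonzero polynomial with at most `k` monomials has no nonzero root of multiplicity `k`. -/
theorem eq_zero_of_pow_card_dvd {β : K} (hβ : β ≠ 0) (s : Finset ℕ) (g : K[X])
    (hs : g.support ⊆ s) (hd : (Polynomial.X - Polynomial.C β) ^ s.card ∣ g) : g = 0 := by
  classical
  induction s using Finset.induction_on generalizing g with
  | empty => simpa using hs
  | insert j s hj ih =>
    rw [Finset.card_insert_of_notMem hj] at hd
    -- The operator `X·d/dX - j` removes the monomial `X^j` and costs one order of vanishing at `β`,
    -- so induction kills the result. Then `g` is a multiple of `X^j`, which has no nonzero root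
    -- unless it is zero.
    have h1 : Polynomial.X * Polynomial.derivative g - Polynomial.C (j : K) * g = 0 := by
      refine ih _ ?_ ?_
      · intro k hk
        have hc : (Polynomial.X * Polynomial.derivative g - Polynomial.C (j : K) * g).coeff k =
            ((k : K) - j) * g.coeff k := by
          rw [Polynomial.coeff_sub, Polynomial.coeff_C_mul]
          cases k with
          | zero => simp
          | succ k =>
            rw [Polynomial.coeff_X_mul, Polynomial.coeff_derivative]
            push_cast
            ring
        rw [Polynomial.mem_support_iff, hc] at hk
        have h2 := hs (Polynomial.mem_support_iff.2 (right_ne_zero_of_mul hk))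
        refine (Finset.mem_insert.1 h2).resolve_left ?_
        rintro rfl
        simp at hk
      · have h2 := Polynomial.pow_sub_one_dvd_derivative_of_pow_dvd hd
        rw [Nat.add_sub_cancel] at h2
        have h3 : (Polynomial.X - Polynomial.C β) ^ s.card ∣ g :=
          (pow_dvd_pow _ (Nat.le_succ _)).trans hd
        exact dvd_sub (h2.mul_left _) (h3.mul_left _)
    have h3 : ∀ k, k ≠ j → g.coeff k = 0 := by
      intro k hk
      have h4 := congrArg (fun p : K[X] => p.coeff k) h1
      simp only [Polynomial.coeff_sub, Polynomial.coeff_C_mul, Polynomial.coeff_zero] at h4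
      have h5 : ((k : K) - j) * g.coeff k = 0 := by
        rw [← h4]
        cases k with
        | zero => simp
        | succ k =>
          rw [Polynomial.coeff_X_mul, Polynomial.coeff_derivative]
          push_cast
          ring
      exact (mul_eq_zero.1 h5).resolve_left (sub_ne_zero.2 (by exact_mod_cast hk))
    have h6 : g = Polynomial.monomial j (g.coeff j) := by
      ext k
      rw [Polynomial.coeff_monomial]
      split_ifs with h
      · rw [h]
      · exact h3 k (Ne.symm h)
    have h7 : g.eval β = 0 :=
      Polynomial.dvd_iff_isRoot.1 ((dvd_pow_self _ (Nat.succ_ne_zero _)).trans hd)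
    rw [h6, Polynomial.eval_monomial] at h7
    rw [h6, (mul_eq_zero.1 h7).resolve_right (pow_ne_zero _ hβ), map_zero]

end Sparse

/-! ### Weighted homogeneous relations in two variables -/

section WeightedHomogeneous

variable {K : Type*} [Field K]

theorem weight_fin_two (n m : ℕ) (d : Fin 2 →₀ ℕ) :
    Finsupp.weight ![n, m] d = d 0 * n + d 1 * m := by
  simp [Finsupp.weight_eq_sum, Fin.sum_univ_two]

/-- The number `d₁m` lies in `[0, N]`, is congruent to `N` modulo `n` and to `0` modulo `m`, hence
lies in a single class modulo the lcm. -/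
theorem card_le_of_weight_eq {n m N : ℕ} (hn : 0 < n) (hm : 0 < m) (s : Finset (Fin 2 →₀ ℕ))
    (hs : ∀ d ∈ s, d 0 * n + d 1 * m = N) :
    (s.image fun d => d 1).card ≤ N / n.lcm m + 1 := by
  have hL : 0 < n.lcm m := Nat.lcm_pos hn hm
  rw [← Finset.card_range (N / n.lcm m + 1)]
  refine Finset.card_le_card_of_injOn (fun j => j * m / n.lcm m) ?_ ?_
  · intro j hj
    obtain ⟨d, hd, rfl⟩ := Finset.mem_image.1 hj
    have h1 := hs d hd
    simp only [Finset.coe_range, Set.mem_Iio]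
    exact Nat.lt_succ_of_le (Nat.div_le_div_right (by omega))
  · intro i hi j hj hij
    obtain ⟨d, hd, rfl⟩ := Finset.mem_image.1 hi
    obtain ⟨e, he, rfl⟩ := Finset.mem_image.1 hj
    have h1 := hs d hd
    have h2 := hs e he
    have h3 : d 1 * m ≡ e 1 * m [MOD n] := by
      have h4 : d 0 * n + d 1 * m ≡ e 0 * n + e 1 * m [MOD n] := by rw [h1, h2]
      simpa [Nat.ModEq, Nat.add_mod] using h4
    have h5 : d 1 * m ≡ e 1 * m [MOD m] := by simp [Nat.ModEq]
    have h6 : d 1 * m ≡ e 1 * m [MOD n.lcm m] := by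
      rw [Nat.modEq_iff_dvd] at h3 h5 ⊢
      exact_mod_cast Int.coe_lcm_dvd h3 h5
    simp only at hij
    have h7 : d 1 * m = e 1 * m := by
      rw [← Nat.div_add_mod (d 1 * m) (n.lcm m), ← Nat.div_add_mod (e 1 * m) (n.lcm m), hij, h6]
    exact Nat.eq_of_mul_eq_mul_right hm h7

theorem eq_of_weight_eq {n m N : ℕ} (hn : 0 < n) {d e : Fin 2 →₀ ℕ}
    (hd : d 0 * n + d 1 * m = N) (he : e 0 * n + e 1 * m = N) (h : d 1 = e 1) : d = e := by
  have h0 : d 0 = e 0 := by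
    rw [h] at hd
    exact Nat.eq_of_mul_eq_mul_right hn (by omega)
  ext i
  fin_cases i
  · exact h0
  · exact h

theorem derivative_aeval_C_X (α : K) (G : MvPolynomial (Fin 2) K) :
    Polynomial.derivative (aeval ![Polynomial.C α, Polynomial.X] G) =
      aeval ![Polynomial.C α, Polynomial.X] (pderiv 1 G) := by
  induction G using MvPolynomial.induction_on with
  | C a => simp
  | add p q hp hq => simp [hp, hq]
  | mul_X p i hp =>
    rw [map_mul, Polynomial.derivative_mul, hp, pderiv_mul, map_add, map_mul, map_mul]
    fin_cases i <;> simp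

variable [CharZero K]

/-- A weighted homogeneous polynomial in two variables all of whose first derivatives vanish at
a pair of nonzero polynomials is zero. -/
theorem eq_zero_of_bind₁_iterate_pderiv_eq_zero {σ : Type*} {n m N : ℕ} (hn : 0 < n) (hm : 0 < m)
    {G : MvPolynomial (Fin 2) K} (hG : IsWeightedHomogeneous ![n, m] G N)
    {F E : MvPolynomial σ K} (hF : F ≠ 0) (hE : E ≠ 0)
    (h : ∀ j ≤ N / n.lcm m, bind₁ ![F, E] ((pderiv 1)^[j] G) = 0) : G = 0 := by
  classical
  -- Specializing at a point where `F` and `E` are nonzero reduces the claim to the one-variable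
  -- polynomial `G(α, y)`, which vanishes to high order at `β`.
  obtain ⟨z, hz⟩ : ∃ z, eval z (F * E) ≠ 0 := by
    by_contra! hcon
    exact mul_ne_zero hF hE (MvPolynomial.funext fun z => by rw [hcon, map_zero])
  rw [map_mul] at hz
  set α := eval z F with hα
  set β := eval z E with hβ
  have hα0 : α ≠ 0 := left_ne_zero_of_mul hz
  have hβ0 : β ≠ 0 := right_ne_zero_of_mul hz
  set g : K[X] := aeval ![Polynomial.C α, Polynomial.X] G with hg
  have hder : ∀ j, Polynomial.derivative^[j] g =
      aeval ![Polynomial.C α, Polynomial.X] ((pderiv 1)^[j] G) := by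
    intro j
    induction j with
    | zero => rfl
    | succ j ih => rw [Function.iterate_succ_apply', Function.iterate_succ_apply', ih,
        derivative_aeval_C_X]
  have heval : ∀ H : MvPolynomial (Fin 2) K,
      (aeval ![Polynomial.C α, Polynomial.X] H : K[X]).eval β = eval z (bind₁ ![F, E] H) := by
    intro H
    induction H using MvPolynomial.induction_on with
    | C a => simp
    | add p q hp hq => simp [hp, hq]
    | mul_X p i hp =>
      rw [map_mul, map_mul, map_mul, Polynomial.eval_mul, hp]
      fin_cases i <;> simp [hα, hβ]
  have hw : ∀ d ∈ G.support, d 0 * n + d 1 * m = N := by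
    intro d hd
    rw [← weight_fin_two]
    exact hG (mem_support_iff.1 hd)
  have hsum : g = ∑ d ∈ G.support, Polynomial.C (coeff d G * α ^ d 0) * Polynomial.X ^ d 1 := by
    rw [hg, aeval_eq_sum_of_support_subset _ G subset_rfl]
    refine Finset.sum_congr rfl fun d _ => ?_
    simp [Fin.prod_univ_two, mul_assoc]
  -- Weighted homogeneity makes the `y`-exponent determine the monomial, so no terms of `G` merge in
  -- `g`.
  have hcoeff : ∀ d ∈ G.support, g.coeff (d 1) = coeff d G * α ^ d 0 := by
    intro d hd
    rw [hsum, Polynomial.finsetSum_coeff, Finset.sum_eq_single_of_mem d hd]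
    · rw [Polynomial.coeff_C_mul_X_pow, if_pos rfl]
    · intro e he hed
      rw [Polynomial.coeff_C_mul_X_pow, if_neg]
      exact fun h1 => hed (eq_of_weight_eq hn (hw e he) (hw d hd) h1.symm)
  have hsupp : g.support ⊆ G.support.image fun d => d 1 := by
    intro k hk
    by_contra hk'
    refine Polynomial.mem_support_iff.1 hk ?_
    rw [hsum, Polynomial.finsetSum_coeff]
    refine Finset.sum_eq_zero fun d hd => ?_
    rw [Polynomial.coeff_C_mul_X_pow, if_neg]
    rintro rfl
    exact hk' (Finset.mem_image_of_mem _ hd)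
  have hg0 : g = 0 := by
    by_contra hne
    refine hne (eq_zero_of_pow_card_dvd hβ0 _ g hsupp ?_)
    refine (pow_dvd_pow _ (card_le_of_weight_eq hn hm G.support hw)).trans ?_
    rw [← Polynomial.le_rootMultiplicity_iff hne]
    refine Nat.succ_le_of_lt
      (Polynomial.lt_rootMultiplicity_of_isRoot_iterate_derivative_of_mem_nonZeroDivisors' hne
        (fun j hj => ?_) fun k _ hk => ?_)
    · rw [Polynomial.IsRoot.def, hder, heval, h j hj, map_zero]
    · exact mem_nonZeroDivisors_of_ne_zero (by exact_mod_cast hk)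
  by_contra hGne
  obtain ⟨d, hd⟩ := support_nonempty.2 hGne
  have := hcoeff d hd
  rw [hg0, Polynomial.coeff_zero] at this
  exact mul_ne_zero (mem_support_iff.1 hd) (pow_ne_zero _ hα0) this.symm

omit [CharZero K] in
/-- Over an algebraically closed field, a weighted homogeneous relation for the weights `(n, n s)`
between `F` and `E` forces `E` to be a multiple of `F ^ s`. -/
theorem eq_C_mul_pow_of_bind₁_eq_zero [IsAlgClosed K] {σ : Type*} {n s N : ℕ} (hn : 0 < n)
    {G : MvPolynomial (Fin 2) K} (hG : IsWeightedHomogeneous ![n, n * s] G N) (hG0 : G ≠ 0)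
    {F E : MvPolynomial σ K} (hF : F ≠ 0) (h : bind₁ ![F, E] G = 0) :
    ∃ c : K, E = C c * F ^ s := by
  classical
  let L := FractionRing (MvPolynomial σ K)
  have hinj : Function.Injective (algebraMap (MvPolynomial σ K) L) :=
    IsFractionRing.injective _ _
  set u : L := algebraMap _ L F with hu
  set v : L := algebraMap _ L E with hv
  have hu0 : u ≠ 0 := (map_ne_zero_iff _ hinj).2 hF
  set g : K[X] := aeval ![Polynomial.C (1 : K), Polynomial.X] G with hg
  have hw : ∀ d ∈ G.support, d 0 * n + d 1 * (n * s) = N := by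
    intro d hd
    rw [← weight_fin_two]
    exact hG (mem_support_iff.1 hd)
  have hsum : g = ∑ d ∈ G.support, Polynomial.C (coeff d G) * Polynomial.X ^ d 1 := by
    rw [hg, aeval_eq_sum_of_support_subset _ G subset_rfl]
    refine Finset.sum_congr rfl fun d _ => ?_
    simp [Fin.prod_univ_two]
  have hg0 : g ≠ 0 := by
    obtain ⟨d, hd⟩ := support_nonempty.2 hG0
    intro h0
    have h1 : g.coeff (d 1) = coeff d G := by
      rw [hsum, Polynomial.finsetSum_coeff, Finset.sum_eq_single_of_mem d hd]
      · simp
      · intro e he hed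
        rw [Polynomial.coeff_C_mul_X_pow, if_neg]
        exact fun h1 => hed (eq_of_weight_eq hn (hw e he) (hw d hd) h1.symm)
    rw [h0, Polynomial.coeff_zero] at h1
    exact mem_support_iff.1 hd h1.symm
  have hrel : Polynomial.aeval (v / u ^ s) g = 0 := by
    have h1 : algebraMap _ L (bind₁ ![F, E] G) =
        ∑ d ∈ G.support, algebraMap K L (coeff d G) * (u ^ d 0 * v ^ d 1) := by
      rw [bind₁, aeval_eq_sum_of_support_subset _ G subset_rfl, map_sum]
      refine Finset.sum_congr rfl fun d _ => ?_
      rw [map_mul, ← IsScalarTower.algebraMap_apply, Fin.prod_univ_two]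
      simp [hu, hv]
    -- Dehomogenization: `G(u, v) = u^(N/n) · g(v/u^s)` with `g(y) = G(1, y)`, so `v/u^s` is
    -- algebraic over `K` and therefore lies in `K`.
    have h2 : algebraMap _ L (bind₁ ![F, E] G) = u ^ (N / n) * Polynomial.aeval (v / u ^ s) g := by
      rw [h1, hsum, map_sum, Finset.mul_sum]
      refine Finset.sum_congr rfl fun d hd => ?_
      have h3 : N / n = d 0 + s * d 1 := by
        rw [← hw d hd]
        refine Nat.div_eq_of_eq_mul_left hn ?_
        ring
      rw [h3, map_mul, Polynomial.aeval_C, map_pow, Polynomial.aeval_X, pow_add, pow_mul]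
      have h4 : v = v / u ^ s * u ^ s := (div_mul_cancel₀ _ (pow_ne_zero _ hu0)).symm
      nth_rewrite 1 [h4]
      rw [mul_pow]
      ring
    rw [h, map_zero] at h2
    exact (mul_eq_zero.1 h2.symm).resolve_left (pow_ne_zero _ hu0)
  have hint : IsAlgebraic K (v / u ^ s) := ⟨g, hg0, hrel⟩
  obtain ⟨c, hc⟩ : ∃ c : K, algebraMap K L c = v / u ^ s := by
    exact minpoly.mem_range_of_degree_eq_one K _ (IsAlgClosed.degree_eq_one_of_irreducible K
      (minpoly.irreducible hint.isIntegral))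
  refine ⟨c, hinj ?_⟩
  rw [eq_div_iff (pow_ne_zero _ hu0)] at hc
  rw [map_mul, map_pow, ← hv, ← hu, ← hc, ← algebraMap_eq, ← IsScalarTower.algebraMap_apply]

end WeightedHomogeneous

/-! ### Plane automorphisms and Jung's theorem -/

section PlaneAutomorphisms

variable {K : Type*} [Field K]

theorem bind₁_bind₁_inv {n : ℕ} (f : PolyAut n K) (h : MvPolynomial (Fin n) K) :
    bind₁ f.1.comp (bind₁ (f⁻¹ : PolyAut n K).1.comp h) = h :=
  (pullbackEquiv n f).symm_apply_apply h

/-- Chain rule applied to the identity `f⁻¹ ∘ f = 1`. -/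
theorem jac_comp_isUnit (f : PolyAut 2 K) : IsUnit (jac (f.1.comp 0) (f.1.comp 1)) := by
  have h := jac_bind₁_bind₁ f.1.comp (bind₁ (f⁻¹ : PolyAut 2 K).1.comp (X 0))
    (bind₁ (f⁻¹ : PolyAut 2 K).1.comp (X 1))
  rw [bind₁_bind₁_inv, bind₁_bind₁_inv, jac_X, mul_comm] at h
  exact IsUnit.of_mul_eq_one _ h.symm

theorem pderiv_eq_zero_iff [CharZero K] {σ : Type*} {i : σ} {p : MvPolynomial σ K} :
    pderiv i p = 0 ↔ ∀ d : σ →₀ ℕ, d i ≠ 0 → coeff d p = 0 := by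
  classical
  constructor
  · intro h d hd
    have h1 := coeff_pderiv (i := i) p (d - Finsupp.single i 1)
    rw [h, coeff_zero, tsub_add_cancel_of_le
      (Finsupp.single_le_iff.2 (Nat.one_le_iff_ne_zero.2 hd))] at h1
    exact (mul_eq_zero.1 h1.symm).resolve_right (Nat.cast_add_one_ne_zero _)
  · intro h
    ext d
    rw [coeff_pderiv, h _ (by simp), zero_mul, coeff_zero]

theorem mem_supported_of_pderiv_eq_zero [CharZero K] {σ : Type*} {s : Set σ}
    {p : MvPolynomial σ K} (h : ∀ i ∉ s, pderiv i p = 0) : p ∈ supported K s := by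
  rw [mem_supported]
  intro i hi
  by_contra his
  obtain ⟨d, hd, hid⟩ := (mem_vars_iff_mem_support i).1 hi
  exact mem_support_iff.1 hd (pderiv_eq_zero_iff.1 (h i his) d (Finsupp.mem_support_iff.1 hid))

/-- When this derivative vanishes, the Jacobian is a product of two diagonal derivatives; being a
unit, it forces both to be nonzero constants. -/
theorem mem_jonquieres_of_pderiv_eq_zero [CharZero K] {f : PolyAut 2 K}
    (h : pderiv 0 (f.1.comp 1) = 0) : f ∈ jonquieres 2 K := by
  have hJ := jac_comp_isUnit f
  rw [jac, h, mul_zero, sub_zero] at hJ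
  obtain ⟨a, ha⟩ := eq_algebraMap_of_isUnit _ (isUnit_of_mul_isUnit_left hJ)
  obtain ⟨d, hd⟩ := eq_algebraMap_of_isUnit _ (isUnit_of_mul_isUnit_right hJ)
  have ha0 : a ≠ 0 := by
    rintro rfl
    simp [ha] at hJ
  have hd0 : d ≠ 0 := by
    rintro rfl
    simp [hd] at hJ
  intro i
  fin_cases i
  · refine ⟨a, ha0, f.1.comp 0 - C a * X 0, mem_supported_of_pderiv_eq_zero fun i hi => ?_,
      by simp⟩
    fin_cases i
    · simp [ha]
    · simp at hi
  · refine ⟨d, hd0, f.1.comp 1 - C d * X 1, mem_supported_of_pderiv_eq_zero fun i hi => ?_,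
      by simp⟩
    fin_cases i
    · simp [h]
    · simp [hd]

/-- The triangular automorphism `(a x + p(y), d y + e)`. -/
noncomputable def triAut (a d : K) (ha : a ≠ 0) (hd : d ≠ 0) (p : K[X]) (e : K) : PolyAut 2 K where
  val := ⟨![C a * X 0 + Polynomial.aeval (X 1) p, C d * X 1 + C e]⟩
  inv := ⟨![C a⁻¹ * X 0 - C a⁻¹ * Polynomial.aeval (C d⁻¹ * X 1 - C (d⁻¹ * e)) p,
    C d⁻¹ * X 1 - C (d⁻¹ * e)]⟩
  val_inv := by
    have ha' : (C a : MvPolynomial (Fin 2) K) * C a⁻¹ = 1 := by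
      rw [← C_mul, mul_inv_cancel₀ ha, C_1]
    have hd' : (C d : MvPolynomial (Fin 2) K) * C d⁻¹ = 1 := by
      rw [← C_mul, mul_inv_cancel₀ hd, C_1]
    ext1
    funext i
    rw [PolyEnd.mul_comp, PolyEnd.one_comp]
    fin_cases i
    · simp [← Polynomial.aeval_algHom_apply]
      linear_combination (X 0 - Polynomial.aeval (C d⁻¹ * X 1 - C d⁻¹ * C e) p) * ha'
    · simp
      linear_combination (X 1 - C e) * hd'
  inv_val := by
    have ha' : (C a : MvPolynomial (Fin 2) K) * C a⁻¹ = 1 := by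
      rw [← C_mul, mul_inv_cancel₀ ha, C_1]
    have hd' : (C d : MvPolynomial (Fin 2) K) * C d⁻¹ = 1 := by
      rw [← C_mul, mul_inv_cancel₀ hd, C_1]
    ext1
    funext i
    rw [PolyEnd.mul_comp, PolyEnd.one_comp]
    have hy : C d⁻¹ * (C d * X 1 + C e) - C d⁻¹ * C e = (X 1 : MvPolynomial (Fin 2) K) := by
      linear_combination X 1 * hd'
    fin_cases i
    · simp [← Polynomial.aeval_algHom_apply, hy]
      linear_combination (X 0) * ha'
    · simp
      linear_combination hy

@[simp] theorem triAut_comp_zero (a d : K) (ha : a ≠ 0) (hd : d ≠ 0) (p : K[X]) (e : K) :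
    (triAut a d ha hd p e).1.comp 0 = C a * X 0 + Polynomial.aeval (X 1) p := rfl

@[simp] theorem triAut_comp_one (a d : K) (ha : a ≠ 0) (hd : d ≠ 0) (p : K[X]) (e : K) :
    (triAut a d ha hd p e).1.comp 1 = C d * X 1 + C e := rfl

theorem supported_fin_two_zero :
    supported K {j : Fin 2 | 0 < j} = (Polynomial.aeval (X 1 : MvPolynomial (Fin 2) K)).range := by
  rw [← Algebra.adjoin_singleton_eq_range_aeval, supported]
  congr 1
  have : {j : Fin 2 | 0 < j} = {1} := by
    ext j
    fin_cases j <;> simp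
  rw [this, Set.image_singleton]

theorem supported_fin_two_one : supported K {j : Fin 2 | 1 < j} = ⊥ := by
  have : {j : Fin 2 | 1 < j} = ∅ := by
    ext j
    fin_cases j <;> simp
  rw [this, supported_empty]

theorem polyAut_ext {f g : PolyAut 2 K} (h0 : f.1.comp 0 = g.1.comp 0)
    (h1 : f.1.comp 1 = g.1.comp 1) : f = g := by
  ext i : 3
  fin_cases i
  · exact h0
  · exact h1

theorem mem_jonquieres_two_iff {f : PolyAut 2 K} :
    f ∈ jonquieres 2 K ↔ ∃ a d, ∃ (ha : a ≠ 0) (hd : d ≠ 0), ∃ p e, f = triAut a d ha hd p e := by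
  constructor
  · intro h
    obtain ⟨a, ha, p, hp, h0⟩ := h 0
    obtain ⟨d, hd, q, hq, h1⟩ := h 1
    rw [supported_fin_two_zero] at hp
    rw [supported_fin_two_one] at hq
    obtain ⟨p, rfl⟩ := hp
    obtain ⟨e, rfl⟩ := Algebra.mem_bot.1 hq
    exact ⟨a, d, ha, hd, p, e, polyAut_ext h0 h1⟩
  · rintro ⟨a, d, ha, hd, p, e, rfl⟩ i
    fin_cases i
    · refine ⟨a, ha, Polynomial.aeval (X 1) p, ?_, rfl⟩
      change _ ∈ supported K {j : Fin 2 | 0 < j}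
      rw [supported_fin_two_zero]
      exact ⟨p, rfl⟩
    · refine ⟨d, hd, C e, ?_, rfl⟩
      exact Subalgebra.algebraMap_mem _ e

theorem triAut_mem (a d : K) (ha : a ≠ 0) (hd : d ≠ 0) (p : K[X]) (e : K) :
    triAut a d ha hd p e ∈ jonquieres 2 K :=
  mem_jonquieres_two_iff.2 ⟨a, d, ha, hd, p, e, rfl⟩

/-- The automorphism `(y, x)`. -/
noncomputable def swapAut (K : Type*) [Field K] : PolyAut 2 K where
  val := ⟨![X 1, X 0]⟩
  inv := ⟨![X 1, X 0]⟩
  val_inv := by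
    ext1
    funext i
    rw [PolyEnd.mul_comp, PolyEnd.one_comp]
    fin_cases i <;> simp
  inv_val := by
    ext1
    funext i
    rw [PolyEnd.mul_comp, PolyEnd.one_comp]
    fin_cases i <;> simp

theorem swapAut_mul_comp_zero (f : PolyAut 2 K) : (swapAut K * f).1.comp 0 = f.1.comp 1 :=
  bind₁_X_right _ _

theorem swapAut_mul_comp_one (f : PolyAut 2 K) : (swapAut K * f).1.comp 1 = f.1.comp 0 :=
  bind₁_X_right _ _

theorem triAut_mul_comp_zero (a d : K) (ha : a ≠ 0) (hd : d ≠ 0) (p : K[X]) (e : K)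
    (f : PolyAut 2 K) : (triAut a d ha hd p e * f).1.comp 0 =
      C a * f.1.comp 0 + Polynomial.aeval (f.1.comp 1) p := by
  change bind₁ f.1.comp (C a * X 0 + Polynomial.aeval (X 1) p) = _
  rw [map_add, map_mul, bind₁_C_right, bind₁_X_right, ← Polynomial.aeval_algHom_apply,
    bind₁_X_right]

theorem triAut_mul_comp_one (a d : K) (ha : a ≠ 0) (hd : d ≠ 0) (p : K[X]) (e : K)
    (f : PolyAut 2 K) : (triAut a d ha hd p e * f).1.comp 1 = C d * f.1.comp 1 + C e := by
  change bind₁ f.1.comp (C d * X 1 + C e) = _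
  rw [map_add, map_mul, bind₁_C_right, bind₁_X_right, bind₁_C_right]

theorem iterate_pderiv_hasTopForm {σ : Type*} {w : σ → ℕ} {i : σ} (j : ℕ) {M : ℕ}
    {G G' : MvPolynomial σ K} (h : HasTopForm w (M + j * w i) G G') :
    HasTopForm w M ((pderiv i)^[j] G) ((pderiv i)^[j] G') := by
  induction j generalizing M with
  | zero => simpa using h
  | succ j ih =>
    rw [Function.iterate_succ_apply', Function.iterate_succ_apply']
    refine HasTopForm.pderiv (ih ?_)
    convert! h using 1
    ring

/-- Repeated application of `jac f₁` to `G(f)`: lower bound for the degree of `G(f)`. -/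
theorem totalDegree_bind₁_iterate_pderiv (f : PolyAut 2 K) (G : MvPolynomial (Fin 2) K) (j : ℕ)
    (hj : bind₁ f.1.comp ((pderiv 1)^[j] G) ≠ 0) :
    (bind₁ f.1.comp ((pderiv 1)^[j] G)).totalDegree + 2 * j ≤
      j * (f.1.comp 0).totalDegree + (bind₁ f.1.comp G).totalDegree := by
  have hJ : jac (f.1.comp 0) (f.1.comp 1) ≠ 0 := (jac_comp_isUnit f).ne_zero
  induction j with
  | zero => simp
  | succ j ih =>
    rw [Function.iterate_succ_apply'] at hj ⊢
    have h1 := jac_bind₁_right f.1.comp ((pderiv 1)^[j] G)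
    have h2 : jac (f.1.comp 0) (bind₁ f.1.comp ((pderiv 1)^[j] G)) ≠ 0 := by
      rw [h1]
      exact mul_ne_zero hj hJ
    have h3 := totalDegree_jac_add_two_le h2
    rw [h1, totalDegree_mul_of_isDomain hj hJ] at h3
    have h4 := ih (fun h0 => h2 (by simp [h0, jac]))
    rw [add_mul, one_mul]
    omega

/-- Otherwise `y`, of weight at least `2`, would occur in neither component of `f⁻¹`, and the
Jacobian would vanish. -/
theorem exists_two_le_weightedTotalDegree (f : PolyAut 2 K) {n m : ℕ} (hm : 2 ≤ m) :
    ∃ i : Fin 2, 2 ≤ weightedTotalDegree ![n, m] (bind₁ (f⁻¹ : PolyAut 2 K).1.comp (X i)) := by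
  by_contra! hcon
  have h0 : ∀ i, pderiv 1 (bind₁ (f⁻¹ : PolyAut 2 K).1.comp (X i)) = 0 := by
    intro i
    refine pderiv_eq_zero_of_notMem_vars fun hv => ?_
    obtain ⟨d, hd, h1⟩ := (mem_vars_iff_mem_support 1).1 hv
    have h2 := le_weightedTotalDegree ![n, m] hd
    rw [weight_fin_two] at h2
    have h3 := hcon i
    have h4 : 1 ≤ d 1 := Nat.one_le_iff_ne_zero.2 (Finsupp.mem_support_iff.1 h1)
    nlinarith
  have h1 := jac_comp_isUnit (f⁻¹)
  have h2 := h0 0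
  have h3 := h0 1
  rw [bind₁_X_right] at h2 h3
  rw [jac, h2, h3] at h1
  simp at h1

theorem hasTopForm_homogeneous {σ : Type*} (p : MvPolynomial σ K) :
    HasTopForm 1 p.totalDegree p (weightedHomogeneousComponent 1 p.totalDegree p) :=
  hasTopForm_weightedHomogeneousComponent _ _ (weightedTotalDegree_one p).le

theorem HasTopForm.totalDegree_lt {σ : Type*} {N : ℕ} {p : MvPolynomial σ K}
    (h : HasTopForm 1 N p 0) (hN : 0 < N) : p.totalDegree < N := by
  rw [← weightedTotalDegree_one]
  exact h.weightedTotalDegree_lt hN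

theorem totalDegree_comp_pos (f : PolyAut 2 K) (i : Fin 2) : 0 < (f.1.comp i).totalDegree := by
  rw [Nat.pos_iff_ne_zero]
  intro h
  have hJ := (jac_comp_isUnit f).ne_zero
  rw [totalDegree_eq_zero_iff_eq_C] at h
  apply hJ
  fin_cases i
  · simp only [Fin.zero_eta] at h
    rw [jac, h]
    simp
  · simp only [Fin.mk_one] at h
    rw [jac, h]
    simp

/-- The larger degree of a plane automorphism can be lowered by subtracting a multiple of a power
of the other component. -/
theorem exists_totalDegree_sub_lt [CharZero K] [IsAlgClosed K] (f : PolyAut 2 K)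
    (hle : (f.1.comp 0).totalDegree ≤ (f.1.comp 1).totalDegree)
    (h2 : 2 ≤ (f.1.comp 1).totalDegree) :
    ∃ (c : K) (s : ℕ), (f.1.comp 1 - C c * f.1.comp 0 ^ s).totalDegree <
      (f.1.comp 1).totalDegree := by
  set n := (f.1.comp 0).totalDegree with hn
  set m := (f.1.comp 1).totalDegree with hm
  have hn0 : 0 < n := totalDegree_comp_pos f 0
  have hm0 : 0 < m := totalDegree_comp_pos f 1
  obtain ⟨i, hi⟩ := exists_two_le_weightedTotalDegree f (n := n) h2
  set G := bind₁ (f⁻¹ : PolyAut 2 K).1.comp (X i) with hG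
  set N := weightedTotalDegree ![n, m] G with hN
  set G' := weightedHomogeneousComponent ![n, m] N G with hG'
  set F := weightedHomogeneousComponent 1 n (f.1.comp 0) with hF
  set E := weightedHomogeneousComponent 1 m (f.1.comp 1) with hE
  have htop : HasTopForm ![n, m] N G G' := hasTopForm_weightedHomogeneousComponent _ _ le_rfl
  have hG'0 : G' ≠ 0 := by
    intro h0
    rw [h0] at htop
    exact (htop.weightedTotalDegree_lt (by omega)).ne rfl
  have hFtop : HasTopForm 1 n (f.1.comp 0) F := hasTopForm_homogeneous _
  have hEtop : HasTopForm 1 m (f.1.comp 1) E := hasTopForm_homogeneous _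
  have hF0 : F ≠ 0 := by
    intro h0
    rw [h0] at hFtop
    exact (hFtop.totalDegree_lt hn0).ne rfl
  have hE0 : E ≠ 0 := by
    intro h0
    rw [h0] at hEtop
    exact (hEtop.totalDegree_lt hm0).ne rfl
  have hsub : ∀ i, HasTopForm 1 (![n, m] i) (f.1.comp i) (![F, E] i) := by
    intro i
    fin_cases i
    · exact hFtop
    · exact hEtop
  have hdeg : (bind₁ f.1.comp G).totalDegree = 1 := by
    rw [hG, bind₁_bind₁_inv, totalDegree_X]
  -- A nonzero value would give `(∂₁^j G)(f)` degree at least `M = N - jm`, whereas `j` Jacobians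
  -- with `f₀`, starting from `G(f) = xᵢ` of degree `1`, bound it by `1 + j(n - 2)`.
  have hvanish : ∀ j M, N = M + j * m → n * j + 1 < M + 2 * j →
      bind₁ ![F, E] ((pderiv 1)^[j] G') = 0 := by
    intro j M hM hlt
    by_contra hne
    have h3 : HasTopForm ![n, m] (M + j * ![n, m] 1) G G' := by
      rw [hM] at htop
      exact htop
    have h4 := (iterate_pderiv_hasTopForm j h3).bind₁ hsub
    have h5 := h4.le_weightedTotalDegree hne
    rw [weightedTotalDegree_one] at h5
    have h6 : bind₁ f.1.comp ((pderiv 1)^[j] G) ≠ 0 := by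
      intro h0
      rw [h0] at h4
      obtain ⟨d, hd⟩ := exists_coeff_ne_zero hne
      exact hd (by rw [← h4.2 d (h4.1 hd).ge, coeff_zero])
    have h7 := totalDegree_bind₁_iterate_pderiv f G j h6
    rw [hdeg, ← hn, mul_comm j n] at h7
    omega
  by_cases hdvd : n ∣ m
  · obtain ⟨s, hs⟩ := hdvd
    have h3 := hvanish 0 N (by simp) (by omega)
    rw [Function.iterate_zero_apply] at h3
    obtain ⟨c, hc⟩ := eq_C_mul_pow_of_bind₁_eq_zero (s := s) hn0 (by rw [← hs]; exact htop.1)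
      hG'0 hF0 h3
    refine ⟨c, s, HasTopForm.totalDegree_lt ?_ hm0⟩
    have h4 := (hFtop.pow s).C_mul c
    rw [← hc, mul_comm, ← hs] at h4
    simpa using hEtop.sub h4
  · exfalso
    refine hG'0 (eq_zero_of_bind₁_iterate_pderiv_eq_zero hn0 hm0 htop.1 hF0 hE0 fun j hj => ?_)
    -- As `n ∤ m`, the lcm is a proper multiple of `m`, hence at least `2m ≥ n + m`. This makes the
    -- vanishing range reach every `j ≤ N / lcm(n, m)`, as the sparse root bound requires.
    have hL : n + m ≤ n.lcm m := by
      obtain ⟨k, hk⟩ := Nat.dvd_lcm_right n m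
      have hk2 : 2 ≤ k := by
        by_contra hk2
        interval_cases k
        · have := Nat.lcm_pos hn0 hm0
          omega
        · exact hdvd (by simpa [hk] using Nat.dvd_lcm_left n m)
      rw [hk]
      nlinarith
    have h3 : j * n.lcm m ≤ N := (Nat.mul_le_mul_right _ hj).trans (Nat.div_mul_le_self _ _)
    have h4 : j * (n + m) ≤ N := (Nat.mul_le_mul_left j hL).trans h3
    rw [mul_add] at h4
    refine hvanish j (N - j * m) (by omega) ?_
    rw [mul_comm n j]
    rcases Nat.eq_zero_or_pos j with rfl | hj0
    · omega
    · omega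

/-- **Jung's theorem**: the triangular automorphisms and the transposition of the coordinates
generate the automorphism group of the affine plane. -/
theorem eq_top_of_jonquieres_le [CharZero K] [IsAlgClosed K] {H : Subgroup (PolyAut 2 K)}
    (hB : jonquieres 2 K ≤ H) (hs : swapAut K ∈ H) : H = ⊤ := by
  rw [eq_top_iff]
  have key : ∀ k, ∀ f : PolyAut 2 K,
      (f.1.comp 0).totalDegree + (f.1.comp 1).totalDegree = k → f ∈ H := by
    intro k
    induction k using Nat.strong_induction_on with
    | _ k ih =>
    intro f hk
    have hswap : ∀ f : PolyAut 2 K, swapAut K * f ∈ H → f ∈ H := fun f hf =>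
      (H.mul_mem_cancel_left hs).1 hf
    have htri : ∀ (p : K[X]) (f : PolyAut 2 K),
        triAut 1 1 one_ne_zero one_ne_zero p 0 * f ∈ H → f ∈ H := fun p f hf =>
      (H.mul_mem_cancel_left (hB (triAut_mem _ _ _ _ _ _))).1 hf
    by_cases hQ : pderiv 0 (f.1.comp 1) = 0
    · exact hB (mem_jonquieres_of_pderiv_eq_zero hQ)
    rcases lt_or_ge (f.1.comp 1).totalDegree (f.1.comp 0).totalDegree with hlt | hge
    · have h1 := totalDegree_comp_pos f 1
      obtain ⟨c, s, hcs⟩ := exists_totalDegree_sub_lt (swapAut K * f)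
        (by rw [swapAut_mul_comp_zero, swapAut_mul_comp_one]; omega)
        (by rw [swapAut_mul_comp_one]; omega)
      rw [swapAut_mul_comp_zero, swapAut_mul_comp_one] at hcs
      refine htri (-(Polynomial.C c * Polynomial.X ^ s)) f (ih _ ?_ _ rfl)
      rw [triAut_mul_comp_zero, triAut_mul_comp_one]
      simp only [C_1, one_mul, C_0, add_zero, map_neg, map_mul, Polynomial.aeval_C, map_pow,
        Polynomial.aeval_X, ← sub_eq_add_neg, algebraMap_eq]
      omega
    rcases lt_or_ge (f.1.comp 1).totalDegree 2 with hlt2 | hge2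
    -- Both degrees are now at most `1`: an elementary map cancels `x` from the first component, and
    -- after a swap the result is triangular.
    · have hconst : ∀ i, ∃ a, pderiv 0 (f.1.comp i) = C a := by
        intro i
        by_cases h0 : pderiv 0 (f.1.comp i) = 0
        · exact ⟨0, by rw [h0, C_0]⟩
        · have h1 := totalDegree_pderiv_add_one_le h0
          have h2 : (f.1.comp i).totalDegree ≤ 1 := by
            fin_cases i
            · exact hge.trans (by omega)
            · exact Nat.le_of_lt_succ hlt2
          exact ⟨_, totalDegree_eq_zero_iff_eq_C.1 (by omega)⟩
      obtain ⟨a, ha⟩ := hconst 0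
      obtain ⟨d, hd⟩ := hconst 1
      have hd0 : d ≠ 0 := by
        rintro rfl
        exact hQ (by rw [hd, C_0])
      refine htri (-(Polynomial.C (a / d) * Polynomial.X)) f (hswap _
        (hB (mem_jonquieres_of_pderiv_eq_zero ?_)))
      rw [swapAut_mul_comp_one, triAut_mul_comp_zero]
      simp only [C_1, one_mul, map_neg, map_mul, Polynomial.aeval_C, Polynomial.aeval_X, map_add,
        algebraMap_eq, pderiv_C_mul, ha, hd]
      rw [← C_mul, div_mul_cancel₀ _ hd0, add_neg_cancel]
    · obtain ⟨c, s, hcs⟩ := exists_totalDegree_sub_lt f hge hge2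
      refine hswap f (htri (-(Polynomial.C c * Polynomial.X ^ s)) _ (ih _ ?_ _ rfl))
      rw [triAut_mul_comp_zero, triAut_mul_comp_one, swapAut_mul_comp_zero, swapAut_mul_comp_one]
      simp only [C_1, one_mul, C_0, add_zero, map_neg, map_mul, Polynomial.aeval_C, map_pow,
        Polynomial.aeval_X, ← sub_eq_add_neg, algebraMap_eq]
      omega
  exact fun f _ => key _ f rfl

end PlaneAutomorphisms

/-! ### Closed subgroups containing the triangular group -/

section Closed

variable {K : Type*} [Field K] [CharZero K]

theorem mem_jonquieres_iff_pderiv_eq_zero {f : PolyAut 2 K} :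
    f ∈ jonquieres 2 K ↔ pderiv 0 (f.1.comp 1) = 0 := by
  refine ⟨fun h => ?_, mem_jonquieres_of_pderiv_eq_zero⟩
  obtain ⟨a, d, ha, hd, p, e, rfl⟩ := mem_jonquieres_two_iff.1 h
  simp

theorem swapAut_notMem_jonquieres : swapAut K ∉ jonquieres 2 K := by
  rw [mem_jonquieres_iff_pderiv_eq_zero]
  change pderiv 0 (X 0 : MvPolynomial (Fin 2) K) ≠ 0
  simp

theorem isClosed_jonquieres_two :
    IsClosed[indTopology 2 K] (jonquieres 2 K : Set (PolyAut 2 K)) := by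
  rw [isClosed_indTopology_iff]
  intro d
  let _ := zariskiTopology (Fin 2 × {m : Fin 2 →₀ ℕ // m.degree ≤ d}) K
  rw [isClosed_induced_iff]
  refine ⟨_, (isClosed_zariskiTopology_iff _).2
    ⟨{P | ∃ m : {m : Fin 2 →₀ ℕ // m.degree ≤ d}, m.1 0 ≠ 0 ∧ P = X (1, m)}, rfl⟩, ?_⟩
  ext f
  rw [Set.mem_preimage, Set.mem_preimage, SetLike.mem_coe, mem_jonquieres_iff_pderiv_eq_zero,
    pderiv_eq_zero_iff]
  constructor
  · intro h m hm
    by_cases hd : m.degree ≤ d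
    · have := h (X (1, ⟨m, hd⟩)) ⟨⟨m, hd⟩, hm, rfl⟩
      rwa [eval_X] at this
    · exact coeff_eq_zero_of_totalDegree_lt ((f.2 1).trans_lt (not_le.1 hd))
  · rintro h _ ⟨m, hm, rfl⟩
    rw [eval_X]
    exact h m.1 hm

omit [CharZero K] in
theorem eval_aeval_polynomial {ι : Type*} (γ : ι → K[X]) (t : K) (P : MvPolynomial ι K) :
    (aeval γ P).eval t = eval (fun q => (γ q).eval t) P := by
  induction P using MvPolynomial.induction_on with
  | C a => simp
  | add p q hp hq => simp [hp, hq]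
  | mul_X p i hp => simp [hp]

/-- A polynomial curve in the space of coefficients whose points with nonzero parameter belong to
a closed set of automorphisms has its limit in this set. -/
theorem mem_of_curve {n D : ℕ} {H : Set (PolyAut n K)} (hH : IsClosed[indTopology n K] H)
    (γ : Fin n × {m : Fin n →₀ ℕ // m.degree ≤ D} → K[X]) (g : K → PolyAut n K)
    (hg : ∀ t, g t ∈ PolyAut.degreeLE n K D)
    (hγ : ∀ t q, PolyAut.coeffs n K D (g t) q = (γ q).eval t)
    (hmem : ∀ t, t ≠ 0 → g t ∈ H) : g 0 ∈ H := by
  have h1 := (isClosed_indTopology_iff H).1 hH D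
  let _ := zariskiTopology (Fin n × {m : Fin n →₀ ℕ // m.degree ≤ D}) K
  rw [isClosed_induced_iff] at h1
  obtain ⟨Z, hZ, hZH⟩ := h1
  obtain ⟨S, rfl⟩ := (isClosed_zariskiTopology_iff Z).1 hZ
  have h2 : ∀ t, g t ∈ H ↔ ∀ P ∈ S, (aeval γ P).eval t = 0 := by
    intro t
    have h3 := Set.ext_iff.1 hZH ⟨g t, hg t⟩
    refine h3.symm.trans (forall₂_congr fun P _ => ?_)
    have h4 : PolyAut.coeffs n K D (g t) = fun q => (γ q).eval t := funext (hγ t)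
    rw [eval_aeval_polynomial, ← h4]
  rw [h2]
  intro P hP
  -- A defining equation pulled back to the curve vanishes for all `t ≠ 0`, infinitely many values,
  -- hence identically.
  have h6 : aeval γ P = 0 := by
    refine Polynomial.eq_zero_of_infinite_isRoot _ ((Set.infinite_univ.sdiff
      (Set.finite_singleton (0 : K))).mono ?_)
    rintro t ⟨-, ht⟩
    exact (h2 t).1 (hmem t ht) P hP
  rw [h6, Polynomial.eval_zero]

theorem coeff_single_eq_eval_pderiv {σ : Type*} (p : MvPolynomial σ K) (i : σ) :
    coeff (Finsupp.single i 1) p = eval 0 (pderiv i p) := by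
  have h := coeff_pderiv (i := i) p 0
  rw [zero_add] at h
  change _ = eval (fun _ => (0 : K)) _
  rw [eval_zero', constantCoeff_eq, h]
  simp

omit [CharZero K] in
theorem coeff_bind₁_C_mul_X {σ : Type*} (t : K) (p : MvPolynomial σ K) (m : σ →₀ ℕ) :
    coeff m (bind₁ (fun i => C t * X i) p) = t ^ m.degree * coeff m p := by
  classical
  induction p using MvPolynomial.induction_on' with
  | add p q hp hq => simp [hp, hq, mul_add]
  | monomial d a =>
    have : bind₁ (fun i => C t * X i) (monomial d a) =
        C (t ^ d.degree) * (monomial d a : MvPolynomial σ K) := by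
      rw [bind₁_monomial, monomial_eq]
      simp only [mul_pow, Finset.prod_mul_distrib, Finsupp.prod, Finset.prod_pow_eq_pow_sum,
        C_pow, Finsupp.degree_apply]
      ring
    rw [this, coeff_C_mul, coeff_monomial]
    split_ifs with h
    · rw [h]
    · simp

/-- A group of plane automorphisms that is closed and contains the triangular group contains the
linear part of each of its elements fixing the origin. -/
theorem mem_of_linear_part {H : Subgroup (PolyAut 2 K)}
    (hH : IsClosed[indTopology 2 K] (H : Set (PolyAut 2 K))) (hB : jonquieres 2 K ≤ H)
    {g l : PolyAut 2 K} (hg : g ∈ H) (h0 : ∀ i, coeff 0 (g.1.comp i) = 0)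
    (hl : ∀ i, l.1.comp i = C (coeff (Finsupp.single 0 1) (g.1.comp i)) * X 0 +
      C (coeff (Finsupp.single 1 1) (g.1.comp i)) * X 1) : l ∈ H := by
  classical
  set D := (g.1.comp 0).totalDegree + (g.1.comp 1).totalDegree with hD
  have hgD : ∀ i, (g.1.comp i).totalDegree ≤ D := by
    intro i
    fin_cases i <;> simp [hD]
  -- The curve `t⁻¹ g(t x)`, extended at `t = 0` by the linear part.
  let G : K → PolyAut 2 K := fun t => if ht : t = 0 then l else
    triAut t⁻¹ t⁻¹ (inv_ne_zero ht) (inv_ne_zero ht) 0 0 * g * triAut t t ht ht 0 0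
  have hG0 : G 0 = l := dif_pos rfl
  have hcoeff : ∀ t, t ≠ 0 → ∀ i m,
      coeff m ((G t).1.comp i) = t⁻¹ * (t ^ m.degree * coeff m (g.1.comp i)) := by
    intro t ht i m
    have h1 : G t = triAut t⁻¹ t⁻¹ (inv_ne_zero ht) (inv_ne_zero ht) 0 0 *
      (g * triAut t t ht ht 0 0) := by
      rw [← mul_assoc]
      exact dif_neg ht
    have h2 : ∀ j, (triAut t t ht ht 0 0).1.comp j = C t * X j := by
      intro j
      fin_cases j <;> simp
    have h3 : (G t).1.comp i = C t⁻¹ * bind₁ (fun j => C t * X j) (g.1.comp i) := by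
      have h4 : (g * triAut t t ht ht 0 0).1.comp i =
          bind₁ (fun j => C t * X j) (g.1.comp i) := by
        rw [← funext h2]
        rfl
      rw [← h4, h1]
      fin_cases i
      · simp only [Fin.zero_eta]
        rw [triAut_mul_comp_zero, map_zero, add_zero]
      · simp only [Fin.mk_one]
        rw [triAut_mul_comp_one, C_0, add_zero]
    rw [h3, coeff_C_mul, coeff_bind₁_C_mul_X]
  have hl' : ∀ i m, coeff m (l.1.comp i) = if m.degree = 1 then coeff m (g.1.comp i) else 0 := by
    intro i m
    have hm : m.degree = m 0 + m 1 := by simp [Finsupp.degree_eq_sum, Fin.sum_univ_two]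
    rw [hl, coeff_add, coeff_C_mul, coeff_C_mul, coeff_X, coeff_X]
    have hne : (Finsupp.single 0 1 : Fin 2 →₀ ℕ) ≠ Finsupp.single 1 1 := by
      simp [Finsupp.single_left_inj]
    by_cases h1 : Finsupp.single 0 1 = m
    · subst h1
      simp [hne.symm]
    by_cases h2 : Finsupp.single 1 1 = m
    · subst h2
      simp [hne]
    rw [if_neg h1, if_neg h2, if_neg, mul_zero, mul_zero, add_zero]
    intro h3
    rw [hm] at h3
    rcases Nat.add_eq_one_iff.1 h3 with ⟨h4, h5⟩ | ⟨h4, h5⟩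
    · apply h2
      ext j
      fin_cases j <;> simp [h4, h5]
    · apply h1
      ext j
      fin_cases j <;> simp [h4, h5]
  -- In degree `0` the truncated exponent would be wrong, but the coefficient vanishes there because
  -- `g` fixes the origin.
  let γ : Fin 2 × {m : Fin 2 →₀ ℕ // m.degree ≤ D} → K[X] := fun q =>
    Polynomial.C (coeff q.2.1 (g.1.comp q.1)) * Polynomial.X ^ (q.2.1.degree - 1)
  have hmain : G 0 ∈ H := by
    refine mem_of_curve hH γ G (fun t i => ?_) (fun t q => ?_) fun t ht => ?_
    · refine Finset.sup_le fun m hm => ?_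
      have h1 : m ∈ (g.1.comp i).support := by
        rw [mem_support_iff] at hm ⊢
        by_cases ht : t = 0
        · rw [ht, hG0, hl'] at hm
          split_ifs at hm with h2
          · exact hm
          · exact absurd rfl hm
        · rw [hcoeff t ht] at hm
          exact right_ne_zero_of_mul (right_ne_zero_of_mul hm)
      exact (le_totalDegree h1).trans (hgD i)
    · change coeff q.2.1 ((G t).1.comp q.1) = _
      simp only [γ, Polynomial.eval_mul, Polynomial.eval_C, Polynomial.eval_pow,
        Polynomial.eval_X]
      by_cases hq : q.2.1.degree = 0
      · have hq0 : q.2.1 = 0 := (Finsupp.degree_eq_zero_iff _).1 hq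
        by_cases ht : t = 0
        · rw [ht, hG0, hl', hq0, h0]
          simp
        · rw [hcoeff t ht, hq0, h0]
          simp
      · obtain ⟨k, hk⟩ := Nat.exists_eq_succ_of_ne_zero hq
        by_cases ht : t = 0
        · rw [ht, hG0, hl', hk]
          cases k <;> simp
        · rw [hcoeff t ht, hk, pow_succ, Nat.succ_sub_one]
          field_simp
    · change G t ∈ H
      simp only [G, dif_neg ht]
      exact H.mul_mem (H.mul_mem (hB (triAut_mem _ _ _ _ _ _)) hg) (hB (triAut_mem _ _ _ _ _ _))
  rwa [hG0] at hmain

/-- A linear automorphism that is not triangular is a product of triangular ones and the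
transposition of the coordinates. -/
theorem exists_linear_eq {a b c d : K} (hc : c ≠ 0) (hdet : a * d - b * c ≠ 0) :
    ∃ β₁ ∈ jonquieres 2 K, ∃ β₂ ∈ jonquieres 2 K,
      (β₁ * (swapAut K * β₂)).1.comp 0 = C a * X 0 + C b * X 1 ∧
      (β₁ * (swapAut K * β₂)).1.comp 1 = C c * X 0 + C d * X 1 := by
  have ha1 : b - a / c * d ≠ 0 := by
    intro h
    apply hdet
    field_simp at h
    linear_combination -h
  -- Bruhat decomposition: `β₂ = (cx + dy, y)`; after the swap, `β₁` adds `a/c` times `cx + dy` to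
  -- `(b - ad/c) y`.
  refine ⟨_, triAut_mem (b - a / c * d) 1 ha1 one_ne_zero
    (Polynomial.C (a / c) * Polynomial.X) 0,
    _, triAut_mem c 1 hc one_ne_zero (Polynomial.C d * Polynomial.X) 0, ?_, ?_⟩
  · rw [triAut_mul_comp_zero, swapAut_mul_comp_zero, swapAut_mul_comp_one]
    simp only [triAut_comp_zero, triAut_comp_one, map_mul, Polynomial.aeval_C, Polynomial.aeval_X,
      algebraMap_eq, C_1, C_0, C_sub]
    have h1 : (C (a / c) : MvPolynomial (Fin 2) K) * C c = C a := by
      rw [← C_mul, div_mul_cancel₀ _ hc]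
    linear_combination (X 0) * h1
  · rw [triAut_mul_comp_one, swapAut_mul_comp_one]
    simp

/-- The triangular subgroup of the plane is maximal among proper closed subgroups. -/
theorem maximal_isClosed_jonquieres_two [IsAlgClosed K] :
    Maximal (fun H : Subgroup (PolyAut 2 K) =>
      IsClosed[indTopology 2 K] (H : Set (PolyAut 2 K)) ∧ H ≠ ⊤) (jonquieres 2 K) := by
  refine ⟨⟨isClosed_jonquieres_two, fun h => swapAut_notMem_jonquieres (K := K) ?_⟩, ?_⟩
  · rw [h]
    trivial
  rintro H ⟨hH, hne⟩ hB f hf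
  by_contra hfB
  apply hne
  refine eq_top_of_jonquieres_le hB ?_
  rw [mem_jonquieres_iff_pderiv_eq_zero] at hfB
  obtain ⟨z, hz⟩ : ∃ z, eval z (pderiv 0 (f.1.comp 1)) ≠ 0 := by
    by_contra! hcon
    exact hfB (MvPolynomial.funext fun z => by rw [hcon, map_zero])
  -- `τ` moves the origin to `z` and the left factor of `g` moves `f(z)` to the origin, so `g` fixes
  -- the origin and its linear part is the Jacobian matrix of `f` at `z`.
  set τ := triAut (1 : K) 1 one_ne_zero one_ne_zero (Polynomial.C (z 0)) (z 1) with hτ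
  set w : Fin 2 → K := fun i => eval z (f.1.comp i) with hw
  set g := triAut (1 : K) 1 one_ne_zero one_ne_zero (Polynomial.C (-w 0)) (-w 1) * (f * τ) with hg
  have hgH : g ∈ H := H.mul_mem (hB (triAut_mem _ _ _ _ _ _))
    (H.mul_mem hf (hB (triAut_mem _ _ _ _ _ _)))
  have hτi : ∀ i, τ.1.comp i = X i + C (z i) := by
    intro i
    fin_cases i <;> simp [hτ]
  have hgi : ∀ i, g.1.comp i = bind₁ (fun i => X i + C (z i)) (f.1.comp i) - C (w i) := by
    intro i
    have h1 : (f * τ).1.comp i = bind₁ (fun i => X i + C (z i)) (f.1.comp i) := by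
      rw [← funext hτi]
      rfl
    rw [← h1]
    fin_cases i
    · simp only [hg, Fin.zero_eta]
      rw [triAut_mul_comp_zero]
      simp [sub_eq_add_neg]
    · simp only [hg, Fin.mk_one]
      rw [triAut_mul_comp_one]
      simp [sub_eq_add_neg]
  have heval : ∀ p : MvPolynomial (Fin 2) K,
      eval 0 (bind₁ (fun i => X i + C (z i)) p) = eval z p := by
    intro p
    induction p using MvPolynomial.induction_on with
    | C a => simp
    | add p q hp hq => rw [map_add, map_add, hp, hq, map_add]
    | mul_X p i hp =>
      rw [map_mul, map_mul, map_mul, hp, bind₁_X_right, map_add, eval_X, eval_C, eval_X,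
        Pi.zero_apply, zero_add]
  have h0 : ∀ i, coeff 0 (g.1.comp i) = 0 := by
    intro i
    rw [← constantCoeff_eq, ← eval_zero']
    change eval 0 _ = _
    rw [hgi, map_sub, heval, eval_C, sub_self]
  have hpd : ∀ i j, coeff (Finsupp.single j 1) (g.1.comp i) = eval z (pderiv j (f.1.comp i)) := by
    intro i j
    rw [coeff_single_eq_eval_pderiv, hgi, map_sub, derivation_bind₁, ← heval]
    congr 1
    fin_cases j <;> simp
  have hdet : eval 0 (jac (g.1.comp 0) (g.1.comp 1)) ≠ 0 :=
    ((jac_comp_isUnit g).map (eval 0)).ne_zero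
  rw [jac, map_sub, map_mul, map_mul] at hdet
  simp only [← coeff_single_eq_eval_pderiv] at hdet
  rw [← hpd] at hz
  obtain ⟨β₁, h1, β₂, h2, h3, h4⟩ := exists_linear_eq hz hdet
  have hmem := mem_of_linear_part hH hB hgH h0 (l := β₁ * (swapAut K * β₂)) (fun i => by
    fin_cases i
    · exact h3
    · exact h4)
  exact (H.mul_mem_cancel_right (hB h2)).1 ((H.mul_mem_cancel_left (hB h1)).1 hmem)

end Closed

/-! ### Degrees of compositions -/

section Degree

variable {K σ : Type*} [Field K]

theorem HasTopForm.totalDegree_eq {N : ℕ} {p q : MvPolynomial σ K} (h : HasTopForm 1 N p q)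
    (hq : q ≠ 0) : p.totalDegree = N := by
  refine le_antisymm ?_ ?_
  · rw [← weightedTotalDegree_one]
    refine Finset.sup_le fun d hd => ?_
    by_contra hlt
    exact mem_support_iff.1 hd (h.coeff_of_lt (not_le.1 hlt))
  · rw [← weightedTotalDegree_one]
    exact h.le_weightedTotalDegree hq

/-- For nonconstant `A` and `p ≠ 0`, only the leading term of `p` contributes in top degree, and a
power of a nonzero leading form is nonzero. -/
theorem totalDegree_aeval (A : MvPolynomial σ K) (p : K[X]) :
    (Polynomial.aeval A p).totalDegree = p.natDegree * A.totalDegree := by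
  classical
  rcases Nat.eq_zero_or_pos A.totalDegree with h0 | hpos
  · rw [h0, mul_zero]
    rw [totalDegree_eq_zero_iff_eq_C] at h0
    rw [h0, ← algebraMap_eq, Polynomial.aeval_algebraMap_apply, algebraMap_eq, totalDegree_C]
  by_cases hp : p = 0
  · simp [hp]
  have hA := hasTopForm_homogeneous A
  set F := weightedHomogeneousComponent 1 A.totalDegree A with hF
  have hF0 : F ≠ 0 := by
    intro h0
    rw [h0] at hA
    exact (hA.totalDegree_lt hpos).ne rfl
  have h1 : HasTopForm 1 (p.natDegree * A.totalDegree) (Polynomial.aeval A p)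
      (C p.leadingCoeff * F ^ p.natDegree) := by
    rw [Polynomial.aeval_eq_sum_range]
    have h2 : C p.leadingCoeff * F ^ p.natDegree = ∑ i ∈ Finset.range (p.natDegree + 1),
        if i = p.natDegree then C p.leadingCoeff * F ^ p.natDegree else 0 := by
      simp
    rw [h2]
    refine HasTopForm.sum _ fun i hi => ?_
    rw [smul_eq_C_mul]
    have h3 := (hA.pow i).C_mul (p.coeff i)
    split_ifs with h
    · subst h
      exact h3
    · refine h3.of_lt ((Nat.mul_lt_mul_right hpos).2 ?_)
      have := Finset.mem_range.1 hi
      omega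
  refine h1.totalDegree_eq (mul_ne_zero ?_ (pow_ne_zero _ hF0))
  rwa [Ne, C_eq_zero, Polynomial.leadingCoeff_eq_zero]

theorem totalDegree_sub_eq_left {A B : MvPolynomial σ K} (h : B.totalDegree < A.totalDegree) :
    (A - B).totalDegree = A.totalDegree := by
  rw [sub_eq_add_neg]
  exact totalDegree_add_eq_left_of_totalDegree_lt (by rwa [totalDegree_neg])

end Degree

/-! ### A proper subgroup strictly containing the triangular group -/

section NotMaximal

variable {K : Type*} [Field K]

variable (K) in
/-- The polynomial `y⁵ + y³ + y²`. -/
noncomputable def quintic : K[X] := Polynomial.X ^ 5 + Polynomial.X ^ 3 + Polynomial.X ^ 2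

variable (K) in
theorem natDegree_quintic : (quintic K).natDegree = 5 := by
  unfold quintic
  compute_degree!

/-- The involution `(-x + p(y), y)`. -/
noncomputable def reflAut (p : K[X]) : PolyAut 2 K :=
  triAut (-1) 1 (neg_ne_zero.2 one_ne_zero) one_ne_zero p 0

theorem reflAut_mul_comp_zero (p : K[X]) (g : PolyAut 2 K) :
    (reflAut p * g).1.comp 0 = Polynomial.aeval (g.1.comp 1) p - g.1.comp 0 := by
  rw [reflAut, triAut_mul_comp_zero, map_neg, C_1]
  ring

theorem reflAut_mul_comp_one (p : K[X]) (g : PolyAut 2 K) :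
    (reflAut p * g).1.comp 1 = g.1.comp 1 := by
  rw [reflAut, triAut_mul_comp_one, C_1, C_0]
  ring

theorem reflAut_mul_reflAut_mul (p : K[X]) (g : PolyAut 2 K) :
    reflAut p * (reflAut p * g) = g := by
  refine polyAut_ext ?_ ?_
  · rw [reflAut_mul_comp_zero, reflAut_mul_comp_zero, reflAut_mul_comp_one, sub_sub_cancel]
  · rw [reflAut_mul_comp_one, reflAut_mul_comp_one]

theorem swapAut_mul_swapAut_mul (g : PolyAut 2 K) : swapAut K * (swapAut K * g) = g := by
  refine polyAut_ext ?_ ?_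
  · rw [swapAut_mul_comp_zero, swapAut_mul_comp_one]
  · rw [swapAut_mul_comp_one, swapAut_mul_comp_zero]

variable (K) in
/-- An involution of the plane which, together with the triangular subgroup, generates a proper
subgroup. -/
noncomputable def longInvolution : PolyAut 2 K :=
  -- A palindrome in involutions, hence an involution. Applied to `(P, Q)`, with `q` the quintic, it
  -- runs the recurrence `U = q(P) - Q`, `V = U³ - P`, `P' = V³ - U`, `Q' = q(P') - V`. The reversed
  -- sequence obeys the same rules, so applying it exchanges `U` and `V`.
  swapAut K * (reflAut (quintic K) * (swapAut K * (reflAut (Polynomial.X ^ 3) * (swapAut K *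
    (reflAut (Polynomial.X ^ 3) * (swapAut K * (reflAut (quintic K) * swapAut K)))))))

theorem longInvolution_mul_mul (g : PolyAut 2 K) :
    longInvolution K * (longInvolution K * g) = g := by
  simp only [longInvolution, mul_assoc, swapAut_mul_swapAut_mul, reflAut_mul_reflAut_mul]

/-- The first new term of the recurrence defining `longInvolution`. -/
noncomputable def firstTerm (g : PolyAut 2 K) : MvPolynomial (Fin 2) K :=
  Polynomial.aeval (g.1.comp 0) (quintic K) - g.1.comp 1

/-- The second new term of the recurrence defining `longInvolution`. -/
noncomputable def secondTerm (g : PolyAut 2 K) : MvPolynomial (Fin 2) K :=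
  firstTerm g ^ 3 - g.1.comp 0

theorem longInvolution_mul_comp_zero (g : PolyAut 2 K) :
    (longInvolution K * g).1.comp 0 = secondTerm g ^ 3 - firstTerm g := by
  simp only [longInvolution, mul_assoc, swapAut_mul_comp_zero, swapAut_mul_comp_one,
    reflAut_mul_comp_zero, reflAut_mul_comp_one, map_pow, Polynomial.aeval_X, firstTerm,
    secondTerm]

theorem longInvolution_mul_comp_one (g : PolyAut 2 K) :
    (longInvolution K * g).1.comp 1 =
      Polynomial.aeval ((longInvolution K * g).1.comp 0) (quintic K) - secondTerm g := by
  rw [longInvolution_mul_comp_zero]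
  simp only [longInvolution, mul_assoc, swapAut_mul_comp_zero, swapAut_mul_comp_one,
    reflAut_mul_comp_zero, reflAut_mul_comp_one, map_pow, Polynomial.aeval_X, firstTerm,
    secondTerm]

theorem firstTerm_longInvolution_mul (g : PolyAut 2 K) :
    firstTerm (longInvolution K * g) = secondTerm g := by
  rw [firstTerm, longInvolution_mul_comp_one, sub_sub_cancel]

theorem secondTerm_longInvolution_mul (g : PolyAut 2 K) :
    secondTerm (longInvolution K * g) = firstTerm g := by
  rw [secondTerm, firstTerm_longInvolution_mul, longInvolution_mul_comp_zero, sub_sub_cancel]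

theorem totalDegree_pow_three {σ : Type*} (A : MvPolynomial σ K) :
    (A ^ 3).totalDegree = 3 * A.totalDegree := by
  have := totalDegree_aeval A (Polynomial.X ^ 3)
  simpa using this

theorem firstTerm_lt_secondTerm {g : PolyAut 2 K}
    (h : (g.1.comp 0).totalDegree < 3 * (firstTerm g).totalDegree) :
    (firstTerm g).totalDegree < (secondTerm g).totalDegree := by
  rw [secondTerm, totalDegree_sub_eq_left (by rwa [totalDegree_pow_three]), totalDegree_pow_three]
  omega

theorem totalDegree_C_mul_add_C {σ : Type*} {a : K} (ha : a ≠ 0) (c : K) (A : MvPolynomial σ K) :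
    (C a * A + C c).totalDegree = A.totalDegree := by
  have h := totalDegree_aeval A (Polynomial.C a * Polynomial.X + Polynomial.C c)
  rw [Polynomial.natDegree_linear ha, one_mul] at h
  simpa using h

theorem firstTerm_lt_secondTerm_of_mem {b : PolyAut 2 K} (hb : b ∈ jonquieres 2 K) :
    (firstTerm b).totalDegree < (secondTerm b).totalDegree := by
  obtain ⟨a, d, ha, hd, p, e, rfl⟩ := mem_jonquieres_two_iff.1 hb
  have h0 := totalDegree_comp_pos (triAut a d ha hd p e) 0
  have h1 : ((triAut a d ha hd p e).1.comp 1).totalDegree = 1 := by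
    rw [triAut_comp_one, totalDegree_C_mul_add_C hd, totalDegree_X]
  refine firstTerm_lt_secondTerm ?_
  rw [firstTerm, totalDegree_sub_eq_left, totalDegree_aeval, natDegree_quintic]
  · omega
  · rw [totalDegree_aeval, natDegree_quintic, h1]
    omega

/-- Run the recurrence backwards: `P = U³ - V` and `Q = q(P) - U`, where the first term dominates
each time. -/
theorem totalDegree_of_secondTerm_lt {g : PolyAut 2 K}
    (h : (secondTerm g).totalDegree < (firstTerm g).totalDegree) :
    (g.1.comp 0).totalDegree = 3 * (firstTerm g).totalDegree ∧
      (g.1.comp 1).totalDegree = 15 * (firstTerm g).totalDegree := by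
  have h0 : g.1.comp 0 = firstTerm g ^ 3 - secondTerm g := by rw [secondTerm, sub_sub_cancel]
  have h1 : g.1.comp 1 = Polynomial.aeval (g.1.comp 0) (quintic K) - firstTerm g := by
    rw [firstTerm, sub_sub_cancel]
  have h2 : (g.1.comp 0).totalDegree = 3 * (firstTerm g).totalDegree := by
    rw [h0, totalDegree_sub_eq_left, totalDegree_pow_three]
    rw [totalDegree_pow_three]
    omega
  refine ⟨h2, ?_⟩
  rw [h1, totalDegree_sub_eq_left, totalDegree_aeval, natDegree_quintic, h2]
  · ring
  · rw [totalDegree_aeval, natDegree_quintic, h2]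
    omega

theorem coeffs_eq_zero_of_natDegree_eq_zero {c₅ c₄ c₃ c₂ c₁ c₀ : K}
    (h : (Polynomial.C c₅ * Polynomial.X ^ 5 + Polynomial.C c₄ * Polynomial.X ^ 4
      + Polynomial.C c₃ * Polynomial.X ^ 3 + Polynomial.C c₂ * Polynomial.X ^ 2
      + Polynomial.C c₁ * Polynomial.X + Polynomial.C c₀).natDegree = 0) :
    c₅ = 0 ∧ c₄ = 0 ∧ c₃ = 0 ∧ c₂ = 0 := by
  have hcoeff := fun k (hk : 0 < k) => Polynomial.coeff_eq_zero_of_natDegree_lt (h.trans_lt hk)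
  have h5 := hcoeff 5 (by norm_num)
  have h4 := hcoeff 4 (by norm_num)
  have h3 := hcoeff 3 (by norm_num)
  have h2 := hcoeff 2 (by norm_num)
  simp at h5 h4 h3 h2
  exact ⟨h5, h4, h3, h2⟩

/-- The only affine symmetry of the quintic modulo constants is the identity. -/
theorem eq_one_of_natDegree_quintic_comp [CharZero K] {a c d : K} (ha : a ≠ 0)
    (h : ((quintic K).comp (Polynomial.C a * Polynomial.X + Polynomial.C c) -
      Polynomial.C d * quintic K).natDegree = 0) : a = 1 ∧ c = 0 ∧ d = 1 := by
  have hexp : (quintic K).comp (Polynomial.C a * Polynomial.X + Polynomial.C c) -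
      Polynomial.C d * quintic K =
      Polynomial.C (a ^ 5 - d) * Polynomial.X ^ 5 + Polynomial.C (5 * a ^ 4 * c) * Polynomial.X ^ 4
      + Polynomial.C (10 * a ^ 3 * c ^ 2 + a ^ 3 - d) * Polynomial.X ^ 3
      + Polynomial.C (10 * a ^ 2 * c ^ 3 + 3 * a ^ 2 * c + a ^ 2 - d) * Polynomial.X ^ 2
      + Polynomial.C (5 * a * c ^ 4 + 3 * a * c ^ 2 + 2 * a * c) * Polynomial.X
      + Polynomial.C (c ^ 5 + c ^ 3 + c ^ 2) := by
    simp only [quintic, Polynomial.add_comp, Polynomial.pow_comp, Polynomial.X_comp, map_add,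
      map_sub, map_mul, map_pow, map_ofNat]
    ring
  rw [hexp] at h
  -- Degree `4` gives `c = 0`; degrees `5`, `3`, `2` then give `a⁵ = a³ = a² = d`.
  obtain ⟨h5, h4, h3, h2⟩ := coeffs_eq_zero_of_natDegree_eq_zero h
  have hc : c = 0 :=
    (mul_eq_zero.1 h4).resolve_left (mul_ne_zero (by norm_num) (pow_ne_zero _ ha))
  subst hc
  have h6 : a ^ 2 * (a - 1) = 0 := by linear_combination h3 - h2
  have ha1 : a = 1 := sub_eq_zero.1 ((mul_eq_zero.1 h6).resolve_left (pow_ne_zero _ ha))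
  subst ha1
  refine ⟨rfl, rfl, ?_⟩
  linear_combination -h5

/-- The crucial degree estimate: no cancellation occurs in products alternating between
`longInvolution` and nontrivial triangular automorphisms. -/
theorem firstTerm_lt_secondTerm_mul [CharZero K] {b g : PolyAut 2 K} (hb : b ∈ jonquieres 2 K)
    (hb1 : b ≠ 1) (hg : (secondTerm g).totalDegree < (firstTerm g).totalDegree) :
    (firstTerm (b * g)).totalDegree < (secondTerm (b * g)).totalDegree := by
  obtain ⟨a, d, ha, hd, r, e, rfl⟩ := mem_jonquieres_two_iff.1 hb
  obtain ⟨hP, hQ⟩ := totalDegree_of_secondTerm_lt hg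
  set P := g.1.comp 0 with hPdef
  set Q := g.1.comp 1 with hQdef
  set S := firstTerm g with hS
  have hQS : Q = Polynomial.aeval P (quintic K) - S := by rw [hS, firstTerm, sub_sub_cancel]
  have hPS : P = S ^ 3 - secondTerm g := by rw [secondTerm, sub_sub_cancel]
  have hb0 : (triAut a d ha hd r e * g).1.comp 0 = C a * P + Polynomial.aeval Q r :=
    triAut_mul_comp_zero ..
  have hb1' : (triAut a d ha hd r e * g).1.comp 1 = C d * Q + C e := triAut_mul_comp_one ..
  have hpos : 0 < S.totalDegree := by omega
  rcases Nat.eq_zero_or_pos r.natDegree with hr | hr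
  · obtain ⟨c, rfl⟩ : ∃ c, r = Polynomial.C c := ⟨_, Polynomial.eq_C_of_natDegree_eq_zero hr⟩
    rw [Polynomial.aeval_C, algebraMap_eq] at hb0
    set q := (quintic K).comp (Polynomial.C a * Polynomial.X + Polynomial.C c) -
      Polynomial.C d * quintic K with hq
    have hU : firstTerm (triAut a d ha hd (Polynomial.C c) e * g) =
        Polynomial.aeval P q - (C (-d) * S + C e) := by
      rw [firstTerm, hb0, hb1', hQS, hq, map_sub, Polynomial.aeval_comp]
      simp only [map_add, map_mul, Polynomial.aeval_C, Polynomial.aeval_X, algebraMap_eq, map_neg]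
      ring
    rcases Nat.eq_zero_or_pos q.natDegree with hq0 | hqpos
    -- The remaining case is `b = (x, y + e)` with `e ≠ 0`, invisible to the quintic. The cubic
    -- detects it: `V' = (S - e)³ - S³ + V` has degree `2 deg S`, more than `U' = S - e`.
    · obtain ⟨rfl, rfl, rfl⟩ := eq_one_of_natDegree_quintic_comp ha hq0
      have he : e ≠ 0 := by
        rintro rfl
        apply hb1
        refine polyAut_ext ?_ ?_
        · rw [triAut_comp_zero]
          simp [PolyEnd.one_comp]
        · rw [triAut_comp_one]
          simp [PolyEnd.one_comp]
      have hqz : q = 0 := by simp [hq]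
      have hU' : firstTerm (triAut 1 1 ha hd (Polynomial.C 0) e * g) = S - C e := by
        rw [hU, hqz, map_zero, C_neg, C_1]
        ring
      have hV : secondTerm (triAut 1 1 ha hd (Polynomial.C 0) e * g) =
          Polynomial.aeval S (Polynomial.C (-3 * e) * Polynomial.X ^ 2 +
            Polynomial.C (3 * e ^ 2) * Polynomial.X + Polynomial.C (-e ^ 3)) -
          (- secondTerm g) := by
        rw [secondTerm, hU', hb0, hPS]
        simp only [map_add, map_mul, map_pow, map_neg, Polynomial.aeval_C, Polynomial.aeval_X,
          algebraMap_eq, C_1, C_0, map_ofNat]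
        ring
      have h3e : -3 * e ≠ 0 := mul_ne_zero (by norm_num) he
      have hdeg : (Polynomial.aeval S (Polynomial.C (-3 * e) * Polynomial.X ^ 2 +
          Polynomial.C (3 * e ^ 2) * Polynomial.X + Polynomial.C (-e ^ 3))).totalDegree =
          2 * S.totalDegree := by
        rw [totalDegree_aeval, Polynomial.natDegree_quadratic h3e]
      rw [hV, hU', totalDegree_sub_eq_left, totalDegree_sub_eq_left, hdeg]
      · omega
      · rw [totalDegree_neg, hdeg]
        omega
      · rw [totalDegree_C]
        exact hpos
    · refine firstTerm_lt_secondTerm ?_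
      have h1 : (C (-d) * S + C e).totalDegree = S.totalDegree :=
        totalDegree_C_mul_add_C (neg_ne_zero.2 hd) e S
      have h2 : 3 * S.totalDegree ≤ (Polynomial.aeval P q).totalDegree := by
        rw [totalDegree_aeval, hP]
        exact Nat.le_mul_of_pos_left _ hqpos
      rw [hU, totalDegree_sub_eq_left (by omega), hb0, totalDegree_C_mul_add_C ha, hP]
      omega
  · refine firstTerm_lt_secondTerm ?_
    -- For nonconstant `r` the term `r(Q)` dominates `aP`, since `Q` has degree `15 deg S` and `P`
    -- only `3 deg S`.
    have h1 : 15 * S.totalDegree ≤ (Polynomial.aeval Q r).totalDegree := by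
      rw [totalDegree_aeval, hQ]
      exact Nat.le_mul_of_pos_left _ hr
    have h2 : (C a * P).totalDegree = 3 * S.totalDegree := by
      have := totalDegree_C_mul_add_C ha 0 P
      rw [C_0, add_zero] at this
      rw [this, hP]
    have h3 : (C a * P + Polynomial.aeval Q r).totalDegree =
        (Polynomial.aeval Q r).totalDegree :=
      totalDegree_add_eq_right_of_totalDegree_lt (by omega)
    have h4 : (firstTerm (triAut a d ha hd r e * g)).totalDegree =
        5 * (Polynomial.aeval Q r).totalDegree := by
      rw [firstTerm, hb0, hb1', totalDegree_sub_eq_left, totalDegree_aeval, natDegree_quintic, h3]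
      rw [totalDegree_C_mul_add_C hd, totalDegree_aeval, natDegree_quintic, h3, hQ]
      omega
    rw [hb0, h3, h4]
    omega

/-- Products `b₀ f b₁ f ⋯ f bₖ` of triangular automorphisms and `f = longInvolution` in which each
`f` increases the degree. -/
inductive IsReducedProduct : PolyAut 2 K → Prop
  | of_mem {b : PolyAut 2 K} (hb : b ∈ jonquieres 2 K) : IsReducedProduct b
  | mul {b g : PolyAut 2 K} (hb : b ∈ jonquieres 2 K) (hg : IsReducedProduct g)
      (h : (firstTerm g).totalDegree < (secondTerm g).totalDegree) :
      IsReducedProduct (b * (longInvolution K * g))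

theorem IsReducedProduct.jonquieres_mul {b g : PolyAut 2 K} (hb : b ∈ jonquieres 2 K)
    (hg : IsReducedProduct g) : IsReducedProduct (b * g) := by
  cases hg with
  | of_mem hb' => exact .of_mem (mul_mem hb hb')
  | mul hb' hg h =>
    rw [← mul_assoc]
    exact .mul (mul_mem hb hb') hg h

/-- Two adjacent copies of the involution cancel if the triangular factor between them is trivial;
otherwise the degree estimate makes the longer product reduced. -/
theorem IsReducedProduct.longInvolution_mul [CharZero K] {g : PolyAut 2 K}
    (hg : IsReducedProduct g) : IsReducedProduct (longInvolution K * g) := by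
  rw [← one_mul (longInvolution K * g)]
  cases hg with
  | of_mem hb => exact .mul (one_mem _) (.of_mem hb) (firstTerm_lt_secondTerm_of_mem hb)
  | @mul b g hb hg h =>
    by_cases hb1 : b = 1
    · rw [hb1, one_mul, one_mul, longInvolution_mul_mul]
      exact hg
    · refine .mul (one_mem _) (.mul hb hg h) (firstTerm_lt_secondTerm_mul hb hb1 ?_)
      rwa [firstTerm_longInvolution_mul, secondTerm_longInvolution_mul]

theorem two_le_totalDegree_jonquieres_mul {b g : PolyAut 2 K} (hb : b ∈ jonquieres 2 K)
    (h : (firstTerm g).totalDegree < (secondTerm g).totalDegree) :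
    2 ≤ ((b * (longInvolution K * g)).1.comp 1).totalDegree := by
  obtain ⟨a, d, ha, hd, r, e, rfl⟩ := mem_jonquieres_two_iff.1 hb
  rw [← firstTerm_longInvolution_mul, ← secondTerm_longInvolution_mul] at h
  rw [triAut_mul_comp_one, totalDegree_C_mul_add_C hd, (totalDegree_of_secondTerm_lt h).2]
  omega

theorem not_isReducedProduct_swapAut [CharZero K] : ¬ IsReducedProduct (swapAut K) := by
  intro h
  generalize hs : swapAut K = s at h
  cases h with
  | of_mem hb => exact swapAut_notMem_jonquieres (hs ▸ hb)
  | mul hb hg h =>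
    have h1 := two_le_totalDegree_jonquieres_mul hb h
    rw [← hs] at h1
    have h2 : ((swapAut K).1.comp 1).totalDegree = 1 :=
      totalDegree_X (R := K) (0 : Fin 2)
    omega

theorem longInvolution_notMem_jonquieres : longInvolution K ∉ jonquieres 2 K := by
  intro h
  have h1 := two_le_totalDegree_jonquieres_mul (one_mem _)
    (firstTerm_lt_secondTerm_of_mem (one_mem (jonquieres 2 K)))
  rw [one_mul, mul_one] at h1
  obtain ⟨a, d, ha, hd, r, e, h⟩ := mem_jonquieres_two_iff.1 h
  rw [h, triAut_comp_one, totalDegree_C_mul_add_C hd, totalDegree_X] at h1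
  omega

/-- The stabilizer of a set of group elements under left translation. -/
def leftStabilizer {G : Type*} [Group G] (P : G → Prop) : Subgroup G where
  carrier := {h | ∀ g, P (h * g) ↔ P g}
  mul_mem' {a b} ha hb g := by rw [mul_assoc, ha, hb]
  one_mem' g := by rw [one_mul]
  inv_mem' {a} ha g := by rw [← ha, mul_inv_cancel_left]

/-- The triangular subgroup of the plane is not maximal among proper subgroups. -/
theorem exists_jonquieres_lt_lt_top [CharZero K] :
    ∃ H : Subgroup (PolyAut 2 K), jonquieres 2 K < H ∧ H < ⊤ := by
  -- Using a stabilizer avoids proving that reduced products are closed under multiplication and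
  -- inversion. It misses the swap, since it sends `1` to a reduced product.
  refine ⟨leftStabilizer IsReducedProduct, ?_, ?_⟩
  · refine SetLike.lt_iff_le_and_exists.2 ⟨fun b hb g => ⟨fun h => ?_, .jonquieres_mul hb⟩,
      longInvolution K, fun g => ⟨fun h => ?_, .longInvolution_mul⟩,
      longInvolution_notMem_jonquieres⟩
    · rw [← inv_mul_cancel_left b g]
      exact h.jonquieres_mul (inv_mem hb)
    · rw [← longInvolution_mul_mul g]
      exact h.longInvolution_mul
  · refine lt_top_iff_ne_top.2 fun h => not_isReducedProduct_swapAut (K := K) ?_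
    have hs : swapAut K ∈ leftStabilizer (IsReducedProduct (K := K)) := by
      rw [h]
      trivial
    have := (hs 1).2 (.of_mem (one_mem _))
    rwa [mul_one] at this

end NotMaximal

theorem mainTheorem1 :
    -- `𝓑ₙ` is maximal among the solvable subgroups of `Aut(𝔸ⁿ_ℂ)`, for all `n ≥ 2`
    (∀ n : ℕ, 2 ≤ n →
      Maximal (fun H : Subgroup (PolyAut n ℂ) => Group.IsSolvable H) (jonquieres n ℂ)) ∧
    -- `𝓑₂` is maximal among the proper closed subgroups of `Aut(𝔸²_ℂ)`
    Maximal (fun H : Subgroup (PolyAut 2 ℂ) =>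
      IsClosed[indTopology 2 ℂ] (H : Set (PolyAut 2 ℂ)) ∧ H ≠ ⊤) (jonquieres 2 ℂ) ∧
    -- `𝓑₂` is not maximal among the proper subgroups of `Aut(𝔸²_ℂ)`
    (∃ H : Subgroup (PolyAut 2 ℂ), jonquieres 2 ℂ < H ∧ H < ⊤) :=
  ⟨fun n _ => maximal_isSolvable_jonquieres n, maximal_isClosed_jonquieres_two,
    exists_jonquieres_lt_lt_top⟩
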